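/- Let $q\in\mathbb{C}$ with $0<|q|<1$, and let $\alpha_1,\alpha_2,\beta_1,\beta_2\in\mathbb{C}\setminus\{0\}$. Write $(a;q)_n=\prod_{k=0}^{n-1}(1-aq^k)$, $(a;q)_\infty=\prod_{j\ge 0}(1-q^ja)$, $(a_1,\dots,a_N;q)_\infty=\prod_i (a_i;q)_\infty$ and $${}_3\phi_2\!\left(\begin{array}{c}a,b,c\\ d,e\end{array};q,w\right)=\sum_{n\ge0}\frac{(a;q)_n(b;q)_n(c;q)_n}{(q;q)_n(d;q)_n(e;q)_n}\,w^n .$$ Fix a logarithm of $q$ and put $q^s=e^{s\log q}$. The variable is $x=e^{z}\neq 0$; powers are $x^s=e^{sz}$, and $qx$, $x/q$ correspond to $z+\log q$, $z-\log q$, so that $(q^{\pm1}x)^s=q^{\pm s}x^s$. The powers $\alpha_i^{-\mu}$ are taken with respect to any logarithm of $\alpha_i$. For a function $g$ set $$\begin{aligned}(E_\mu g)(x)={}&\Bigl(x-\tfrac{q^{\mu+1}\beta_1}{\alpha_1\alpha_2}\Bigr)\Bigl(x-\tfrac{q^{\mu+1}\beta_2}{\alpha_1\alpha_2}\Bigr)g(x/q)+q\Bigl(x-\tfrac1{\alpha_1}\Bigr)\Bigl(x-\tfrac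 q{\alpha_2}\Bigr)g(qx)\\&-\Bigl\{(1+q)x^2-\Bigl(q^{\mu+1}\tfrac{\beta_1+\beta_2}{\alpha_1\alpha_2}+\tfrac q{\alpha_1}+\tfrac{q^2}{\alpha_2}\Bigr)x+\Bigl(1+\tfrac{\beta_1\beta_2}{\alpha_1\alpha_2}\Bigr)\tfrac{q^{\mu+2}}{\alpha_1\alpha_2}\Bigr\}g(x).\end{aligned}$$ Let $\lambda\in\mathbb{C}$ with $q^\lambda=q^\mu\beta_1\beta_2/(\alpha_1\alpha_2)$. Each assertion below is made for every $x$ such that no denominator in the defining formula of $g$ (neither a factor $(\cdot;q)_\infty$ of the prefactor nor a factor $(d;q)_n$, $(e;q)_n$ of the series) vanishes at $x/q$, $x$, $qx$. (1) If $\mu$ is real and $\mu>0$, then each of the three functions $$g(x)=(q-1)\alpha_1^{-\mu}\frac{(q^{\lambda+1}/(\alpha_1x),q,\alpha_2/\alpha_1;q)_\infty}{(q/(\alpha_1x),\beta_1/\alpha_1,\beta_2/\alpha_1;q)_\infty}\,{}_3\phi_2\!\left(\begin{array}{c}q/(\alpha_1x),\beta_1/\alpha_1,\beta_2/\alpha_1\\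 q^{\lambda+1}/(\alpha_1x),\alpha_2/\alpha_1\end{array};q,q^\mu\right),$$ $$g(x)=(q-1)q^\mu\alpha_2^{-\mu}\frac{(q^{\lambda+2}/(\alpha_2x),q^2\alpha_1/\alpha_2,q;q)_\infty}{(q^2/(\alpha_2x),q\beta_1/\alpha_2,q\beta_2/\alpha_2;q)_\infty}\,{}_3\phi_2\!\left(\begin{array}{c}q^2/(\alpha_2x),q\beta_1/\alpha_2,q\beta_2/\alpha_2\\ q^{\lambda+2}/(\alpha_2x),q^2\alpha_1/\alpha_2\end{array};q,q^\mu\right),$$ $$g(x)=(q-1)q^{-\lambda\mu}x^\mu\frac{(q,q^{-\lambda+1}\alpha_1x,q^{-\lambda}\alpha_2x;q)_\infty}{(q^{-\lambda+1},q^{-\lambda}\beta_1x,q^{-\lambda}\beta_2x;q)_\infty}\,{}_3\phi_2\!\left(\begin{array}{c}q^{-\lambda+1},q^{-\lambda}\beta_1x,q^{-\lambda}\beta_2x\\ q^{-\lambda+1}\alpha_1x,q^{-\lambda}\alpha_2x\end{array};q,q^\mu\right)$$ (the cases $\xi=1/\alpha_1$, $1/\alpha_2$, $q^{-\lambda}x$)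 satisfies $E_\mu g=0$. (2) For every $\mu\in\mathbb{C}$ (in particular for $\mu>0$), each of the two functions $$g(x)=\frac{(1-q)\beta_1}{\alpha_1}x^\lambda\frac{(\beta_1x,q,q\beta_1/\beta_2;q)_\infty}{(q^{-\lambda}x\beta_1,\beta_1/\alpha_1,q\beta_1/\alpha_2;q)_\infty}\,{}_3\phi_2\!\left(\begin{array}{c}q^{-\lambda}\beta_1x,\beta_1/\alpha_1,q\beta_1/\alpha_2\\ \beta_1x,q\beta_1/\beta_2\end{array};q,q\right),$$ $$g(x)=\frac{(1-q)q}{\alpha_1}x^{\lambda-1}\frac{(q,q^2/(\beta_1x),q^2/(\beta_2x);q)_\infty}{(q/(\alpha_1x),q^2/(\alpha_2x),q^{1-\lambda};q)_\infty}\,{}_3\phi_2\!\left(\begin{array}{c}q/(\alpha_1x),q^2/(\alpha_2x),q^{1-\lambda}\\ q^2/(\beta_1x),q^2/(\beta_2x)\end{array};q,q\right)$$ (the cases $\xi=1/\beta_1$, $x$) satisfies $$(E_\mu g)(x)+\frac{q(1-q)(1-q^\lambda)}{\alpha_1}x^{\lambda+1}=0 .$$ -/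

import Mathlib

namespace QMC

/-- The finite `q`-Pochhammer symbol `(a; q)_n = (1 - a) (1 - a q) ⋯ (1 - a q ^ (n - 1))`. -/
noncomputable def qPoch (q a : ℂ) (n : ℕ) : ℂ :=
  ∏ k ∈ Finset.range n, (1 - a * q ^ k)

/-- The infinite `q`-Pochhammer symbol `(a; q)_∞ = ∏_{j ≥ 0} (1 - q ^ j a)`. -/
noncomputable def qPochInf (q a : ℂ) : ℂ :=
  ∏' j : ℕ, (1 - q ^ j * a)

/-- `(a, b, c; q)_∞ = (a; q)_∞ (b; q)_∞ (c; q)_∞`. -/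
noncomputable def qPochInf3 (q a b c : ℂ) : ℂ :=
  qPochInf q a * qPochInf q b * qPochInf q c

/-- The `n`-th term of the basic hypergeometric series `₃φ₂(a, b, c; d, e; q, w)`. -/
noncomputable def phi32Term (q a b c d e w : ℂ) (n : ℕ) : ℂ :=
  (qPoch q a n * qPoch q b n * qPoch q c n) /
    (qPoch q q n * qPoch q d n * qPoch q e n) * w ^ n

/-- The basic hypergeometric series `₃φ₂(a, b, c; d, e; q, w)`. -/
noncomputable def phi32 (q a b c d e w : ℂ) : ℂ :=
  ∑' n : ℕ, phi32Term q a b c d e w n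

/-- The infinite product defining `(a; q)_∞` converges for `|q| < 1`. -/
theorem multipliable_qPochInf {q : ℂ} (hq : ‖q‖ < 1) (a : ℂ) :
    Multipliable fun j : ℕ => 1 - q ^ j * a := by
  have h : Summable fun j : ℕ => ‖-(q ^ j * a)‖ := by
    simp only [norm_neg, norm_mul, norm_pow]
    exact (summable_geometric_of_lt_one (norm_nonneg q) hq).mul_right _
  simpa only [sub_eq_add_neg] using multipliable_one_add_of_summable h

/-- The `₃φ₂` series converges absolutely for `|q| < 1` and `|w| < 1`. -/
theorem summable_phi32Term {q w : ℂ} (hq : ‖q‖ < 1) (hw : ‖w‖ < 1) (a b c d e : ℂ) :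
    Summable (phi32Term q a b c d e w) := by
  obtain ⟨r, hwr, hr⟩ := exists_between hw
  have hqn : Filter.Tendsto (fun n : ℕ => q ^ n) Filter.atTop (nhds 0) :=
    tendsto_pow_atTop_nhds_zero_of_norm_lt_one hq
  have hfac : ∀ s : ℂ, Filter.Tendsto (fun n : ℕ => 1 - s * q ^ n) Filter.atTop (nhds 1) := by
    intro s
    simpa using (hqn.const_mul s).const_sub 1
  have hlim : Filter.Tendsto (fun n : ℕ =>
      ((1 - a * q ^ n) * (1 - b * q ^ n) * (1 - c * q ^ n)) /
        ((1 - q * q ^ n) * (1 - d * q ^ n) * (1 - e * q ^ n)) * w)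
      Filter.atTop (nhds w) := by
    have h := ((((hfac a).mul (hfac b)).mul (hfac c)).div
      (((hfac q).mul (hfac d)).mul (hfac e)) (by norm_num)).mul_const w
    simpa using h
  refine summable_of_ratio_norm_eventually_le (r := r) hr ?_
  filter_upwards [hlim.norm.eventually (gt_mem_nhds hwr)] with n hn
  have hstep : phi32Term q a b c d e w (n + 1) =
      (((1 - a * q ^ n) * (1 - b * q ^ n) * (1 - c * q ^ n)) /
        ((1 - q * q ^ n) * (1 - d * q ^ n) * (1 - e * q ^ n)) * w) *
        phi32Term q a b c d e w n := by
    simp only [phi32Term, qPoch, Finset.prod_range_succ, pow_succ, div_eq_mul_inv, mul_inv]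
    ring
  rw [hstep, norm_mul]
  exact mul_le_mul_of_nonneg_right hn.le (norm_nonneg _)

/-- The power `c ^ s` of the number `c = exp L`, for the branch given by the logarithm `L` of `c`.
Below `τ` is a logarithm of `q` and `z` is a logarithm of `x`, so that `z + τ` and `z - τ` are
the logarithms of `q x` and `x / q` for which `(q x) ^ s = q ^ s x ^ s`. -/
noncomputable def lpow (L s : ℂ) : ℂ :=
  Complex.exp (s * L)

/-- The left-hand side, at the point `x = exp z`, of the homogeneous second-order
`q`-difference equation for `g`, where `g` is a function of a logarithm of the variable. -/
noncomputable def eqLHS (q τ α₁ α₂ β₁ β₂ μ : ℂ) (g : ℂ → ℂ) (z : ℂ) : ℂ :=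
  let x := Complex.exp z
  (x - lpow τ (μ + 1) * β₁ / (α₁ * α₂)) * (x - lpow τ (μ + 1) * β₂ / (α₁ * α₂)) * g (z - τ)
    + q * (x - 1 / α₁) * (x - q / α₂) * g (z + τ)
    - ((1 + q) * x ^ 2
        - (lpow τ (μ + 1) * ((β₁ + β₂) / (α₁ * α₂)) + q / α₁ + q ^ 2 / α₂) * x
        + (1 + β₁ * β₂ / (α₁ * α₂)) * (lpow τ (μ + 2) / (α₁ * α₂))) * g z

/-- The function for `ξ = 1 / α₁`; `A₁` is the logarithm of `α₁` used in `α₁ ^ (-μ)`. -/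
noncomputable def gInvAlpha₁ (q τ α₁ α₂ β₁ β₂ l μ A₁ : ℂ) (z : ℂ) : ℂ :=
  let x := Complex.exp z
  (q - 1) * lpow A₁ (-μ)
    * (qPochInf3 q (lpow τ (l + 1) / (α₁ * x)) q (α₂ / α₁)
        / qPochInf3 q (q / (α₁ * x)) (β₁ / α₁) (β₂ / α₁))
    * phi32 q (q / (α₁ * x)) (β₁ / α₁) (β₂ / α₁)
        (lpow τ (l + 1) / (α₁ * x)) (α₂ / α₁) (lpow τ μ)

/-- The function for `ξ = 1 / α₂`; `A₂` is the logarithm of `α₂` used in `α₂ ^ (-μ)`. -/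
noncomputable def gInvAlpha₂ (q τ α₁ α₂ β₁ β₂ l μ A₂ : ℂ) (z : ℂ) : ℂ :=
  let x := Complex.exp z
  (q - 1) * lpow τ μ * lpow A₂ (-μ)
    * (qPochInf3 q (lpow τ (l + 2) / (α₂ * x)) (q ^ 2 * α₁ / α₂) q
        / qPochInf3 q (q ^ 2 / (α₂ * x)) (q * β₁ / α₂) (q * β₂ / α₂))
    * phi32 q (q ^ 2 / (α₂ * x)) (q * β₁ / α₂) (q * β₂ / α₂)
        (lpow τ (l + 2) / (α₂ * x)) (q ^ 2 * α₁ / α₂) (lpow τ μ)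

/-- The function for `ξ = q ^ (-λ) x`. -/
noncomputable def gQLamX (q τ α₁ α₂ β₁ β₂ l μ : ℂ) (z : ℂ) : ℂ :=
  let x := Complex.exp z
  (q - 1) * lpow τ (-(l * μ)) * lpow z μ
    * (qPochInf3 q q (lpow τ (-l + 1) * α₁ * x) (lpow τ (-l) * α₂ * x)
        / qPochInf3 q (lpow τ (-l + 1)) (lpow τ (-l) * β₁ * x) (lpow τ (-l) * β₂ * x))
    * phi32 q (lpow τ (-l + 1)) (lpow τ (-l) * β₁ * x) (lpow τ (-l) * β₂ * x)
        (lpow τ (-l + 1) * α₁ * x) (lpow τ (-l) * α₂ * x) (lpow τ μ)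

/-- The function for `ξ = 1 / β₁`. -/
noncomputable def gInvBeta₁ (q τ α₁ α₂ β₁ β₂ l : ℂ) (z : ℂ) : ℂ :=
  let x := Complex.exp z
  (1 - q) * β₁ / α₁ * lpow z l
    * (qPochInf3 q (β₁ * x) q (q * β₁ / β₂)
        / qPochInf3 q (lpow τ (-l) * x * β₁) (β₁ / α₁) (q * β₁ / α₂))
    * phi32 q (lpow τ (-l) * β₁ * x) (β₁ / α₁) (q * β₁ / α₂) (β₁ * x) (q * β₁ / β₂) q

/-- The function for `ξ = x`. -/
noncomputable def gX (q τ α₁ α₂ β₁ β₂ l : ℂ) (z : ℂ) : ℂ :=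
  let x := Complex.exp z
  (1 - q) * q / α₁ * lpow z (l - 1)
    * (qPochInf3 q q (q ^ 2 / (β₁ * x)) (q ^ 2 / (β₂ * x))
        / qPochInf3 q (q / (α₁ * x)) (q ^ 2 / (α₂ * x)) (lpow τ (1 - l)))
    * phi32 q (q / (α₁ * x)) (q ^ 2 / (α₂ * x)) (lpow τ (1 - l))
        (q ^ 2 / (β₁ * x)) (q ^ 2 / (β₂ * x)) q

end QMC

open QMC

/-! Write `M` for `q^μ` and `L` for `q^λ`. Up to a constant factor each `g` is a Jackson-type sum of
a kernel `K(x, s)` over a geometric progression of points `s`. The kernel satisfies `K(x/q, s) (x -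
qLs) = K(x, s) (x - qs)` and `K(qx, s) (x - s) = K(x, s) (x - Ls)`, so applying `E_μ` in `x`
multiplies `K` by a rational function of `s`, computed in `kernel_telescope`. The first-order
recurrence of `K` under `s ↦ qs` turns the result into `F(qs) - F(s)`, where `F(s) = c K (1 - α₁s)
(1 - α₂s/q) / (x - s)` and `c = q² (L - 1) x / (α₁α₂)`. Only boundary values of `F` then remain.

On progressions tending to `s = 0` the series argument is `M`, and `F → 0` because the summable
kernel does; hence the homogeneous equation when `|M| < 1`. On progressions tending to `s = ∞` the
argument is `q`, so `μ` is unrestricted, but `K` decays only like `1/s` while its rational factor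
grows like `s`: `F` has a nonzero limit, the inhomogeneous term. At the finite end `F` vanishes if
the progression starts at a zero of one of its factors (`1/α₁`, `q/α₂`, `1/β₁`). If the progression
moves with `x`, the sums at `x/q`, `x`, `qx` are out of step and their few unmatched terms cancel
against `F`. The four resulting lemmas are `sum_fixed_alpha`, `sum_shifted_alpha`, `sum_fixed_beta`
and `sum_shifted_beta`. -/

namespace QMC
open Filter Topology

/-! ### The operator applied to the kernel -/

/-- Coefficient of `g (x / q)`. -/
noncomputable def coeffDown (q α₁ α₂ β₁ β₂ M x : ℂ) : ℂ :=
  (x - q * M * β₁ / (α₁ * α₂)) * (x - q * M * β₂ / (α₁ * α₂))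

/-- Coefficient of `g (q x)`. -/
noncomputable def coeffUp (q α₁ α₂ x : ℂ) : ℂ :=
  q * (x - 1 / α₁) * (x - q / α₂)

/-- Minus the coefficient of `g x`. -/
noncomputable def coeffMid (q α₁ α₂ β₁ β₂ M x : ℂ) : ℂ :=
  (1 + q) * x ^ 2 - (q * M * ((β₁ + β₂) / (α₁ * α₂)) + q / α₁ + q ^ 2 / α₂) * x
    + (1 + β₁ * β₂ / (α₁ * α₂)) * (q ^ 2 * M / (α₁ * α₂))

/-- The telescoping identity for a kernel `K (x, s)`, of which `K`, `Km`, `Kp` are the values at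
`x`, `x / q`, `q x`. -/
theorem kernel_telescope {q α₁ α₂ β₁ β₂ L M x s K Km Kp : ℂ} (hq : q ≠ 0)
    (hα₁ : α₁ ≠ 0) (hα₂ : α₂ ≠ 0)
    (hL : L = M * (β₁ * β₂) / (α₁ * α₂)) (h1 : x - s ≠ 0) (h2 : x - q * L * s ≠ 0)
    (hm : Km * (x - q * L * s) = K * (x - q * s)) (hp : Kp * (x - s) = K * (x - L * s)) :
    coeffDown q α₁ α₂ β₁ β₂ M x * Km + coeffUp q α₁ α₂ x * Kp - coeffMid q α₁ α₂ β₁ β₂ M x * K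
      = K * (q ^ 2 * (L - 1) * x / (α₁ * α₂)) *
        (M * (1 - β₁ * s) * (1 - β₂ * s) / (x - q * L * s)
          - (1 - α₁ * s) * (1 - α₂ * s / q) / (x - s)) := by
  unfold coeffDown coeffUp coeffMid
  -- This is the claim with `Km`, `Kp` eliminated, `K` divided out and `(x - s) (x - qLs)` cleared:
  -- a polynomial identity in `x` and `s` that holds because of the value of `L`.
  have key : (x - q * M * β₁ / (α₁ * α₂)) * (x - q * M * β₂ / (α₁ * α₂)) * (x - q * s) * (x - s)
      + q * (x - 1 / α₁) * (x - q / α₂) * (x - L * s) * (x - q * L * s)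
      - ((1 + q) * x ^ 2 - (q * M * ((β₁ + β₂) / (α₁ * α₂)) + q / α₁ + q ^ 2 / α₂) * x
    + (1 + β₁ * β₂ / (α₁ * α₂)) * (q ^ 2 * M / (α₁ * α₂))) * (x - s) * (x - q * L * s)
      = (q ^ 2 * (L - 1) * x / (α₁ * α₂)) *
        (M * (1 - β₁ * s) * (1 - β₂ * s) * (x - s)
          - (1 - α₁ * s) * (1 - α₂ * s / q) * (x - q * L * s)) := by
    subst hL
    field_simp
    ring
  have e1 : M * (1 - β₁ * s) * (1 - β₂ * s) / (x - q * L * s) * (x - q * L * s)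
      = M * (1 - β₁ * s) * (1 - β₂ * s) := div_mul_cancel₀ _ h2
  have e2 : (1 - α₁ * s) * (1 - α₂ * s / q) / (x - s) * (x - s)
      = (1 - α₁ * s) * (1 - α₂ * s / q) := div_mul_cancel₀ _ h1
  apply mul_right_cancel₀ (mul_ne_zero h2 h1)
  linear_combination (x - q * M * β₁ / (α₁ * α₂)) * (x - q * M * β₂ / (α₁ * α₂)) * (x - s) * hm
    + q * (x - 1 / α₁) * (x - q / α₂) * (x - q * L * s) * hp + K * key
    - K * (q ^ 2 * (L - 1) * x / (α₁ * α₂)) * ((x - s) * e1 - (x - q * L * s) * e2)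

/-! ### Infinite q-Pochhammer symbols -/

theorem qPochInf_eq_mul {q : ℂ} (hq : ‖q‖ < 1) (a : ℂ) :
    qPochInf q a = (1 - a) * qPochInf q (q * a) := by
  have h : Multipliable fun j : ℕ => 1 - q ^ (j + 1) * a := by
    simpa [pow_succ, mul_assoc] using multipliable_qPochInf hq (q * a)
  have := tprod_eq_zero_mul' (f := fun j : ℕ => 1 - q ^ j * a) h
  simpa [qPochInf, pow_succ, mul_assoc] using this

theorem qPochInf_ne_zero {q : ℂ} (hq : ‖q‖ < 1) {a : ℂ} (ha : ∀ n : ℕ, a * q ^ n ≠ 1) :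
    qPochInf q a ≠ 0 := by
  have h : Summable fun j : ℕ => ‖-(q ^ j * a)‖ := by
    simp only [norm_neg, norm_mul, norm_pow]
    exact (summable_geometric_of_lt_one (norm_nonneg q) hq).mul_right _
  have := tprod_one_add_ne_zero_of_summable (f := fun j : ℕ => -(q ^ j * a))
    (fun n => by
      rw [← sub_eq_add_neg, sub_ne_zero, mul_comm]
      exact (ha n).symm) h
  simpa only [← sub_eq_add_neg, qPochInf] using this

theorem qPoch_mul_qPochInf {q : ℂ} (hq : ‖q‖ < 1) (a : ℂ) (n : ℕ) :
    qPoch q a n * qPochInf q (a * q ^ n) = qPochInf q a := by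
  have h : Multipliable fun j : ℕ => 1 - q ^ (j + n) * a := by
    simpa [pow_add, mul_assoc, mul_comm a] using multipliable_qPochInf hq (a * q ^ n)
  have := Multipliable.prod_mul_tprod_nat_mul' (f := fun j : ℕ => 1 - q ^ j * a) h
  simpa [qPochInf, qPoch, pow_add, mul_assoc, mul_comm a] using this

theorem tendsto_qPoch {q : ℂ} (hq : ‖q‖ < 1) (a : ℂ) :
    Tendsto (qPoch q a) atTop (𝓝 (qPochInf q a)) := by
  have h := (multipliable_qPochInf hq a).tendsto_prod_tprod_nat
  simp only [mul_comm _ a] at h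
  unfold qPochInf
  simp only [mul_comm _ a]
  exact h

theorem qPoch_ne_zero {q a : ℂ} (ha : ∀ n : ℕ, a * q ^ n ≠ 1) (n : ℕ) : qPoch q a n ≠ 0 :=
  Finset.prod_ne_zero_iff.2 fun k _ => sub_ne_zero.2 (ha k).symm

/-- The tail of the product is `(a; q)_∞ / (a; q)_n`, and the denominator tends to the nonzero
numerator. -/
theorem tendsto_qPochInf_mul_pow {q : ℂ} (hq : ‖q‖ < 1) {a : ℂ} (ha : ∀ n : ℕ, a * q ^ n ≠ 1) :
    Tendsto (fun n : ℕ => qPochInf q (a * q ^ n)) atTop (𝓝 1) := by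
  have h := (tendsto_const_nhds (x := qPochInf q a)).div (tendsto_qPoch hq a)
    (qPochInf_ne_zero hq ha)
  rw [div_self (qPochInf_ne_zero hq ha)] at h
  refine h.congr fun n => ?_
  rw [Pi.div_apply, ← qPoch_mul_qPochInf hq a n, mul_div_cancel_left₀ _ (qPoch_ne_zero ha n)]

/-! ### Jackson summands and their q-shifts -/

/-- The summand `(d qⁿ, e qⁿ, f qⁿ; q)_∞ / (a qⁿ, b qⁿ, c qⁿ; q)_∞ wⁿ` of a Jackson integral. -/
noncomputable def jTerm (q a b c d e f w : ℂ) (n : ℕ) : ℂ :=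
  qPochInf q (d * q ^ n) * qPochInf q (e * q ^ n) * qPochInf q (f * q ^ n) /
    (qPochInf q (a * q ^ n) * qPochInf q (b * q ^ n) * qPochInf q (c * q ^ n)) * w ^ n

/-- No factor of `(a; q)_∞` vanishes. -/
def Reg (q a : ℂ) : Prop := ∀ n : ℕ, a * q ^ n ≠ 1

theorem Reg.inf {q a : ℂ} (hq : ‖q‖ < 1) (h : Reg q a) (n : ℕ) : qPochInf q (a * q ^ n) ≠ 0 :=
  qPochInf_ne_zero hq fun k => by rw [mul_assoc, ← pow_add]; exact h _

theorem Reg.sub_ne {q a : ℂ} (h : Reg q a) (n : ℕ) : 1 - a * q ^ n ≠ 0 := sub_ne_zero.2 (h n).symm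

theorem Reg.mul {q a : ℂ} (h : Reg q a) : Reg q (q * a) := fun n => by
  have := h (n + 1)
  rwa [pow_succ, ← mul_assoc, mul_right_comm, mul_comm a] at this

theorem reg_self {q : ℂ} (hq : ‖q‖ < 1) : Reg q q := fun n h => by
  have h1 : ‖q ^ (n + 1)‖ < 1 := by
    rw [norm_pow]; exact pow_lt_one₀ (norm_nonneg _) hq (Nat.succ_ne_zero n)
  rw [pow_succ', h] at h1
  simp at h1

theorem jTerm_eq {q a b c d e w : ℂ} (hq : ‖q‖ < 1) (ha : Reg q a) (hb : Reg q b)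
    (hc : Reg q c) (hd : Reg q d) (he : Reg q e) (n : ℕ) :
    jTerm q a b c d e q w n =
      qPochInf3 q d e q / qPochInf3 q a b c * phi32Term q a b c d e w n := by
  unfold jTerm qPochInf3 phi32Term
  rw [← qPoch_mul_qPochInf hq a n, ← qPoch_mul_qPochInf hq b n, ← qPoch_mul_qPochInf hq c n,
    ← qPoch_mul_qPochInf hq d n, ← qPoch_mul_qPochInf hq e n, ← qPoch_mul_qPochInf hq q n]
  have := qPoch_ne_zero ha n
  have := qPoch_ne_zero hb n
  have := qPoch_ne_zero hc n
  have := qPoch_ne_zero hd n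
  have := qPoch_ne_zero he n
  have := qPoch_ne_zero (reg_self hq) n
  have := ha.inf hq n
  have := hb.inf hq n
  have := hc.inf hq n
  field_simp

theorem hasSum_jTerm {q a b c d e w : ℂ} (hq : ‖q‖ < 1) (hw : ‖w‖ < 1) (ha : Reg q a)
    (hb : Reg q b) (hc : Reg q c) (hd : Reg q d) (he : Reg q e) :
    HasSum (jTerm q a b c d e q w)
      (qPochInf3 q d e q / qPochInf3 q a b c * phi32 q a b c d e w) := by
  rw [funext (jTerm_eq hq ha hb hc hd he)]
  exact (summable_phi32Term hq hw a b c d e).hasSum.mul_left _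

theorem qPochInf_mul_pow {q : ℂ} (hq : ‖q‖ < 1) (a : ℂ) (n : ℕ) :
    qPochInf q (a * q ^ n) = (1 - a * q ^ n) * qPochInf q (a * q ^ (n + 1)) := by
  rw [qPochInf_eq_mul hq]
  congr 2
  ring

/-- The `x`-shift of the kernel on a progression independent of `x`: only `a` and `d` contain `x`.
-/
theorem jTerm_shift_ad {q a b c d e f w : ℂ} (hq : ‖q‖ < 1) (ha : Reg q a) (n : ℕ) :
    jTerm q (q * a) b c (q * d) e f w n * (1 - d * q ^ n) =
      jTerm q a b c d e f w n * (1 - a * q ^ n) := by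
  unfold jTerm
  rw [qPochInf_mul_pow hq a, qPochInf_mul_pow hq d]
  have h : ∀ u : ℂ, q * u * q ^ n = u * q ^ (n + 1) := fun u => by ring
  rw [h, h]
  have := ha.sub_ne n
  -- Nothing is assumed about `b` and `c`; if their symbols vanish, both quotients are `0` by
  -- convention.
  by_cases h0 : qPochInf q (b * q ^ n) * qPochInf q (c * q ^ n) = 0
  · rw [mul_assoc _ (qPochInf q (b * q ^ n)), mul_assoc _ (qPochInf q (b * q ^ n)), h0]
    simp
  have hb := left_ne_zero_of_mul h0
  have hc := right_ne_zero_of_mul h0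
  have ha' := ha.inf hq (n + 1)
  generalize qPochInf q (a * q ^ (n + 1)) = A' at *
  generalize qPochInf q (b * q ^ n) = B' at *
  generalize qPochInf q (c * q ^ n) = C' at *
  generalize qPochInf q (d * q ^ (n + 1)) = D' at *
  generalize qPochInf q (e * q ^ n) = E' at *
  generalize qPochInf q (f * q ^ n) = F' at *
  generalize 1 - a * q ^ n = a₁ at *
  generalize 1 - b * q ^ n = b₁ at *
  generalize 1 - c * q ^ n = c₁ at *
  generalize 1 - d * q ^ n = d₁ at *
  generalize 1 - e * q ^ n = e₁ at *
  generalize 1 - f * q ^ n = f₁ at *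
  field_simp

/-- The recurrence of the kernel along the progression, which makes the sum telescope. -/
theorem jTerm_succ {q a b c d e f w : ℂ} (hq : ‖q‖ < 1) (ha : Reg q a) (hb : Reg q b)
    (hc : Reg q c) (n : ℕ) :
    jTerm q a b c d e f w (n + 1) * ((1 - d * q ^ n) * (1 - e * q ^ n) * (1 - f * q ^ n)) =
      w * jTerm q a b c d e f w n * ((1 - a * q ^ n) * (1 - b * q ^ n) * (1 - c * q ^ n)) := by
  unfold jTerm
  rw [qPochInf_mul_pow hq a n, qPochInf_mul_pow hq b n, qPochInf_mul_pow hq c n,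
    qPochInf_mul_pow hq d n, qPochInf_mul_pow hq e n, qPochInf_mul_pow hq f n]
  have := ha.sub_ne n
  have := hb.sub_ne n
  have := hc.sub_ne n
  have := ha.inf hq (n + 1)
  have := hb.inf hq (n + 1)
  have := hc.inf hq (n + 1)
  generalize qPochInf q (a * q ^ (n + 1)) = A' at *
  generalize qPochInf q (b * q ^ (n + 1)) = B' at *
  generalize qPochInf q (c * q ^ (n + 1)) = C' at *
  generalize qPochInf q (d * q ^ (n + 1)) = D' at *
  generalize qPochInf q (e * q ^ (n + 1)) = E' at *
  generalize qPochInf q (f * q ^ (n + 1)) = F' at *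
  generalize 1 - a * q ^ n = a₁ at *
  generalize 1 - b * q ^ n = b₁ at *
  generalize 1 - c * q ^ n = c₁ at *
  generalize 1 - d * q ^ n = d₁ at *
  generalize 1 - e * q ^ n = e₁ at *
  generalize 1 - f * q ^ n = f₁ at *
  rw [pow_succ]
  field_simp

/-- The `x`-shift on a progression proportional to `x`: `a` and `f` depend on `s/x` only and stay,
the other four move by `q`. The same point `s` then has a different index, whence `n + 1` against
`n`. -/
theorem jTerm_shift_bcde {q a b c d e f w : ℂ} (hq : ‖q‖ < 1) (ha : Reg q a) (hb : Reg q b)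
    (hc : Reg q c) (n : ℕ) :
    jTerm q a b c d e f w (n + 1) * (1 - f * q ^ n) =
      w * jTerm q a (q * b) (q * c) (q * d) (q * e) f w n * (1 - a * q ^ n) := by
  unfold jTerm
  rw [qPochInf_mul_pow hq a n, qPochInf_mul_pow hq f n]
  have h : ∀ u : ℂ, q * u * q ^ n = u * q ^ (n + 1) := fun u => by ring
  simp only [h]
  have := ha.sub_ne n
  have := ha.inf hq (n + 1)
  have := hb.inf hq (n + 1)
  have := hc.inf hq (n + 1)
  generalize qPochInf q (a * q ^ (n + 1)) = A' at *
  generalize qPochInf q (b * q ^ (n + 1)) = B' at *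
  generalize qPochInf q (c * q ^ (n + 1)) = C' at *
  generalize qPochInf q (d * q ^ (n + 1)) = D' at *
  generalize qPochInf q (e * q ^ (n + 1)) = E' at *
  generalize qPochInf q (f * q ^ (n + 1)) = F' at *
  generalize 1 - a * q ^ n = a₁ at *
  generalize 1 - b * q ^ n = b₁ at *
  generalize 1 - c * q ^ n = c₁ at *
  generalize 1 - d * q ^ n = d₁ at *
  generalize 1 - e * q ^ n = e₁ at *
  generalize 1 - f * q ^ n = f₁ at *
  rw [pow_succ]
  field_simp

theorem tendsto_jTerm_div {q a b c d e f w : ℂ} (hq : ‖q‖ < 1) (hw : w ≠ 0) (ha : Reg q a)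
    (hb : Reg q b) (hc : Reg q c) (hd : Reg q d) (he : Reg q e) (hf : Reg q f) :
    Tendsto (fun n => jTerm q a b c d e f w n / w ^ n) atTop (𝓝 1) := by
  have h := (((tendsto_qPochInf_mul_pow hq hd).mul (tendsto_qPochInf_mul_pow hq he)).mul
    (tendsto_qPochInf_mul_pow hq hf)).div (((tendsto_qPochInf_mul_pow hq ha).mul
    (tendsto_qPochInf_mul_pow hq hb)).mul (tendsto_qPochInf_mul_pow hq hc)) (by norm_num)
  simp only [mul_one, div_one] at h
  refine h.congr fun n => ?_
  unfold jTerm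
  rw [mul_div_cancel_right₀ _ (pow_ne_zero n hw)]
  rfl

/-! ### Telescoping over the four kinds of progressions -/

/-- Summation of a telescoping three-term relation between three shifted sequences. -/
theorem eq_of_partial_sums {u v w G : ℕ → ℂ} {A B C U V W g : ℂ} (i j k : ℕ) (hu : HasSum u U)
    (hv : HasSum v V) (hw : HasSum w W) (hG : Tendsto G atTop (𝓝 g))
    (h0 : A * ∑ m ∈ Finset.range i, u m + B * ∑ m ∈ Finset.range j, v m
      - C * ∑ m ∈ Finset.range k, w m = G 0)
    (h : ∀ n, A * u (n + i) + B * v (n + j) - C * w (n + k) = G (n + 1) - G n) :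
    A * U + B * V - C * W = g := by
  have key : ∀ n, A * ∑ m ∈ Finset.range (n + i), u m + B * ∑ m ∈ Finset.range (n + j), v m
      - C * ∑ m ∈ Finset.range (n + k), w m = G n := by
    intro n
    induction n with
    | zero => simpa using h0
    | succ n ih =>
      simp only [add_right_comm n 1, Finset.sum_range_succ]
      linear_combination ih + h n
  have hl := ((((tendsto_add_atTop_iff_nat i).2 hu.tendsto_sum_nat).const_mul A).add
    (((tendsto_add_atTop_iff_nat j).2 hv.tendsto_sum_nat).const_mul B)).sub
    (((tendsto_add_atTop_iff_nat k).2 hw.tendsto_sum_nat).const_mul C)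
  exact tendsto_nhds_unique (hl.congr key) hG

section
variable {q α₁ α₂ β₁ β₂ L M x : ℂ}

/-- As `s → 0` the rational factor tends to `1/x`, so decay of the kernel suffices. -/
theorem tendsto_certificate_zero {K : ℕ → ℂ} {s₀ : ℂ} (hq1 : ‖q‖ < 1)
    (hx : x ≠ 0) (hK : Tendsto K atTop (𝓝 0)) (c : ℂ) :
    Tendsto (fun n => K n * c * ((1 - α₁ * (s₀ * q ^ n)) * (1 - α₂ * (s₀ * q ^ n) / q)
      / (x - s₀ * q ^ n))) atTop (𝓝 0) := by
  have hs : Tendsto (fun n : ℕ => s₀ * q ^ n) atTop (𝓝 0) := by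
    simpa using (tendsto_pow_atTop_nhds_zero_of_norm_lt_one hq1).const_mul s₀
  have h := (hK.mul_const c).mul ((((hs.const_mul α₁).const_sub 1).mul
    (((hs.const_mul α₂).div_const q).const_sub 1)).div (hs.const_sub x) (by simpa using hx))
  simpa using h

/-- Here `s = s₀ qⁿ`. The boundary term vanishes at `s₀` by `h0` and in the limit `s → 0`. -/
theorem sum_fixed_alpha {K Km Kp : ℕ → ℂ} {s₀ S Sm Sp : ℂ} (hq : q ≠ 0)
    (hq1 : ‖q‖ < 1) (hα₁ : α₁ ≠ 0) (hα₂ : α₂ ≠ 0) (hx : x ≠ 0)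
    (hL : L = M * (β₁ * β₂) / (α₁ * α₂))
    (h0 : (1 - α₁ * s₀) * (1 - α₂ * s₀ / q) = 0)
    (h1 : ∀ n, x - s₀ * q ^ n ≠ 0) (h2 : ∀ n, x - q * L * (s₀ * q ^ n) ≠ 0)
    (hm : ∀ n, Km n * (x - q * L * (s₀ * q ^ n)) = K n * (x - q * (s₀ * q ^ n)))
    (hp : ∀ n, Kp n * (x - s₀ * q ^ n) = K n * (x - L * (s₀ * q ^ n)))
    (hK : ∀ n, K (n + 1) * ((x - q * L * (s₀ * q ^ n)) * (1 - α₁ * (s₀ * q ^ (n + 1))) *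
        (1 - α₂ * (s₀ * q ^ n))) =
      M * K n * ((x - s₀ * q ^ (n + 1)) * (1 - β₁ * (s₀ * q ^ n)) * (1 - β₂ * (s₀ * q ^ n))))
    (hS : HasSum K S) (hSm : HasSum Km Sm) (hSp : HasSum Kp Sp) :
    coeffDown q α₁ α₂ β₁ β₂ M x * Sm + coeffUp q α₁ α₂ x * Sp
      - coeffMid q α₁ α₂ β₁ β₂ M x * S = 0 := by
  refine eq_of_partial_sums 0 0 0 hSm hSp hS
    (tendsto_certificate_zero (α₁ := α₁) (α₂ := α₂) (s₀ := s₀) hq1 hx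
      hS.summable.tendsto_atTop_zero (q ^ 2 * (L - 1) * x / (α₁ * α₂))) ?_ ?_
  · simp [h0]
  · intro n
    rw [add_zero, kernel_telescope hq hα₁ hα₂ hL (h1 n) (h2 n) (hm n) (hp n), mul_sub]
    congr 1
    have e : α₂ * (s₀ * q ^ (n + 1)) / q = α₂ * (s₀ * q ^ n) := by
      rw [pow_succ]; field_simp
    generalize q ^ 2 * (L - 1) * x / (α₁ * α₂) = c
    rw [e, ← mul_div_assoc, ← mul_div_assoc, div_eq_div_iff (h2 n) (h1 _)]
    linear_combination (-c) * hK n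

/-- The progression is `s = (x/L) qⁿ`, so `Km (n + 2)`, `K (n + 1)` and `Kp n` belong to the same
`s`. The unmatched terms are `Km 0` at `s = x/(qL)`, and `Km 1`, `K 0` at `s = x/L`; together they
equal the boundary term at `s = qx/L`. -/
theorem sum_shifted_alpha {K Km Kp : ℕ → ℂ} {S Sm Sp : ℂ} (hq : q ≠ 0)
    (hq1 : ‖q‖ < 1) (hα₁ : α₁ ≠ 0) (hα₂ : α₂ ≠ 0) (hβ₁ : β₁ ≠ 0) (hβ₂ : β₂ ≠ 0) (hx : x ≠ 0)
    (hM0 : M ≠ 0)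
    (hL : L = M * (β₁ * β₂) / (α₁ * α₂))
    (h1 : ∀ n : ℕ, 1 - q ^ (n + 1) / L ≠ 0) (h2 : ∀ n : ℕ, 1 - q ^ (n + 1) ≠ 0)
    (hm0 : Km 0 * (M * (1 - β₁ * (x / L / q)) * (1 - β₂ * (x / L / q))) =
      K 0 * ((1 - α₁ * (x / L)) * (1 - α₂ * (x / L / q))))
    (hm : ∀ n, Km (n + 1) * (1 - q ^ (n + 1)) = K n * (1 - q ^ (n + 1) / L))
    (hp : ∀ n, Kp n * (1 - q ^ (n + 1) / L) = K (n + 1) * (1 - q ^ (n + 1)))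
    (hK : ∀ n, K (n + 1) * ((1 - q ^ (n + 1)) * (1 - α₁ * (x / L * q ^ (n + 1))) *
        (1 - α₂ * (x / L * q ^ n))) =
      M * K n * ((1 - q ^ (n + 1) / L) * (1 - β₁ * (x / L * q ^ n)) * (1 - β₂ * (x / L * q ^ n))))
    (hS : HasSum K S) (hSm : HasSum Km Sm) (hSp : HasSum Kp Sp) :
    coeffDown q α₁ α₂ β₁ β₂ M x * Sm + coeffUp q α₁ α₂ x * Sp
      - coeffMid q α₁ α₂ β₁ β₂ M x * S = 0 := by
  have hL0 : L ≠ 0 := by rw [hL]; positivity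
  have hx2 : ∀ n : ℕ, x - q * L * (x / L * q ^ n) = x * (1 - q ^ (n + 1)) := fun n => by
    field_simp; ring
  have hx1 : ∀ n : ℕ, x - x / L * q ^ n = x * (1 - q ^ n / L) := fun n => by
    field_simp
  have hx1' : ∀ n : ℕ, x - q * (x / L * q ^ n) = x * (1 - q ^ (n + 1) / L) := fun n => by
    field_simp; ring
  have hx2' : ∀ n : ℕ, x - L * (x / L * q ^ n) = x * (1 - q ^ n) := fun n => by
    field_simp
  have e : ∀ n : ℕ, α₂ * (x / L * q ^ (n + 1)) / q = α₂ * (x / L * q ^ n) := fun n => by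
    rw [pow_succ]; field_simp
  have hstep : ∀ n : ℕ, K n * (q ^ 2 * (L - 1) * x / (α₁ * α₂)) *
      (M * (1 - β₁ * (x / L * q ^ n)) * (1 - β₂ * (x / L * q ^ n)) / (x * (1 - q ^ (n + 1)))) =
      K (n + 1) * (q ^ 2 * (L - 1) * x / (α₁ * α₂)) * ((1 - α₁ * (x / L * q ^ (n + 1))) *
        (1 - α₂ * (x / L * q ^ (n + 1)) / q) / (x - x / L * q ^ (n + 1))) := fun n => by
    generalize q ^ 2 * (L - 1) * x / (α₁ * α₂) = c
    rw [e, hx1, ← mul_div_assoc, ← mul_div_assoc, div_eq_div_iff (mul_ne_zero hx (h2 n))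
      (mul_ne_zero hx (h1 _))]
    linear_combination (-c) * x * hK n
  refine eq_of_partial_sums 2 0 1 hSm hSp hS
    ((tendsto_add_atTop_iff_nat 1).2 (tendsto_certificate_zero (α₁ := α₁) (α₂ := α₂) (s₀ := x / L)
      hq1 hx hS.summable.tendsto_atTop_zero (q ^ 2 * (L - 1) * x / (α₁ * α₂)))) ?_ ?_
  · rw [← hstep 0]
    have hm1 := hm 0
    simp only [Finset.sum_range_succ, Finset.sum_range_zero, zero_add, pow_one, pow_zero, mul_one,
      mul_zero, add_zero] at hm1 ⊢
    have hq1' : 1 - q ≠ 0 := by simpa using h2 0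
    have hm1' := eq_div_of_mul_eq hq1' hm1
    -- At `s = x/(qL)` the denominator `x - qLs` is zero and the kernel identity is unavailable.
    -- Instead, `coeffDown` is `q²LM/(α₁α₂)` times `(1 - β₁s) (1 - β₂s)`, exactly the factor in
    -- `hm0`.
    have hA : coeffDown q α₁ α₂ β₁ β₂ M x * Km 0 = q ^ 2 * L / (α₁ * α₂) *
        (K 0 * ((1 - α₁ * (x / L)) * (1 - α₂ * (x / L / q)))) := by
      rw [← hm0]; unfold coeffDown; rw [hL]; field_simp; ring
    rw [mul_add, hA, hm1']
    unfold coeffDown coeffMid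
    rw [hL]
    field_simp
    ring
  · intro n
    have hx1n := h1 n
    rw [kernel_telescope (K := K (n + 1)) (s := x / L * q ^ (n + 1)) hq hα₁ hα₂ hL
      (by rw [hx1]; exact mul_ne_zero hx (h1 n)) (by rw [hx2]; exact mul_ne_zero hx (h2 _))
      (by rw [hx2, hx1']; linear_combination x * hm (n + 1))
      (by rw [hx1, hx2']; linear_combination x * hp n), mul_sub, hx2, hstep (n + 1)]

/-- The boundary term at the end `s → ∞` of a lattice `s = s₀ q ^ (-n)`. -/
theorem tendsto_certificate_infty {K : ℕ → ℂ} {t₀ : ℂ} (hq : q ≠ 0) (hq1 : ‖q‖ < 1)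
    (hα₁ : α₁ ≠ 0) (hα₂ : α₂ ≠ 0) (hM : M ≠ 0) (hβ₁ : β₁ ≠ 0) (hβ₂ : β₂ ≠ 0)
    (ht₀ : t₀ ≠ 0) (hL : L = M * (β₁ * β₂) / (α₁ * α₂))
    (hK : Tendsto (fun n => K n / q ^ n) atTop (𝓝 1)) :
    Tendsto (fun n => -(K n * (q ^ 2 * (L - 1) * x / (α₁ * α₂)) *
      (M * (1 - β₁ * (1 / (t₀ * q ^ n))) * (1 - β₂ * (1 / (t₀ * q ^ n)))
        / (x - q * L * (1 / (t₀ * q ^ n)))))) atTop (𝓝 (q * (L - 1) * x / t₀)) := by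
  have hL0 : L ≠ 0 := by rw [hL]; positivity
  have hqn : Tendsto (fun n : ℕ => t₀ * q ^ n) atTop (𝓝 0) := by
    simpa using (tendsto_pow_atTop_nhds_zero_of_norm_lt_one hq1).const_mul t₀
  have h := ((hK.mul_const (q ^ 2 * (L - 1) * x / (α₁ * α₂) / t₀)).mul
    ((((hqn.sub_const β₁).mul (hqn.sub_const β₂)).const_mul M).div
      ((hqn.const_mul x).sub_const (q * L)) (by simp [hq, hL0]))).neg
  -- The value of `L` gives `Mβ₁β₂ = Lα₁α₂`, which removes `M` and the parameters from the limit.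
  have e : -(1 * (q ^ 2 * (L - 1) * x / (α₁ * α₂) / t₀) *
      (M * ((0 - β₁) * (0 - β₂)) / (x * 0 - q * L))) = q * (L - 1) * x / t₀ := by
    rw [mul_zero, zero_sub, zero_sub, zero_sub]
    have : M * (-β₁ * -β₂) = L * (α₁ * α₂) := by rw [hL]; field_simp
    rw [this]
    field_simp
  rw [e] at h
  refine h.congr fun n => ?_
  have hy : q ^ n ≠ 0 := pow_ne_zero n hq
  have : x - q * L * (1 / (t₀ * q ^ n)) = (x * (t₀ * q ^ n) - q * L) / (t₀ * q ^ n) := by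
    field_simp
  rw [this]
  simp only [Pi.div_apply]
  generalize x * (t₀ * q ^ n) - q * L = D
  generalize q ^ 2 * (L - 1) * x / (α₁ * α₂) = c
  by_cases hD : D = 0
  · simp [hD]
  field_simp

/-- Here `s = 1/(β₁qⁿ)` runs to infinity, so the boundary term is used in its `β`-form and with
opposite sign. It vanishes at `s = 1/β₁`; the right-hand side is its limit at infinity. -/
theorem sum_fixed_beta {K Km Kp : ℕ → ℂ} {S Sm Sp : ℂ} (hq : q ≠ 0)
    (hq1 : ‖q‖ < 1) (hα₁ : α₁ ≠ 0) (hα₂ : α₂ ≠ 0) (hβ₁ : β₁ ≠ 0) (hβ₂ : β₂ ≠ 0)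
    (hM : M ≠ 0) (hL : L = M * (β₁ * β₂) / (α₁ * α₂))
    (h1 : ∀ n, 1 - x * (β₁ * q ^ n) ≠ 0) (h2 : ∀ n, q * L - x * (β₁ * q ^ n) ≠ 0)
    (hm : ∀ n, Km n * (q * L - x * (β₁ * q ^ n)) = K n * (q - x * (β₁ * q ^ n)))
    (hp : ∀ n, Kp n * (1 - x * (β₁ * q ^ n)) = K n * (L - x * (β₁ * q ^ n)))
    (hK : ∀ n, K (n + 1) * ((1 - β₁ * x * q ^ n) * (1 - q * β₁ / β₂ * q ^ n) * (1 - q * q ^ n)) =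
      q * K n * ((1 - β₁ * x / L * q ^ n) * (1 - β₁ / α₁ * q ^ n) * (1 - q * β₁ / α₂ * q ^ n)))
    (hlim : Tendsto (fun n => K n / q ^ n) atTop (𝓝 1))
    (hS : HasSum K S) (hSm : HasSum Km Sm) (hSp : HasSum Kp Sp) :
    coeffDown q α₁ α₂ β₁ β₂ M x * Sm + coeffUp q α₁ α₂ x * Sp
      - coeffMid q α₁ α₂ β₁ β₂ M x * S = q * (L - 1) * x / β₁ := by
  have hL0 : L ≠ 0 := by rw [hL]; positivity
  have d1 : ∀ n, x - 1 / (β₁ * q ^ n) = -(1 - x * (β₁ * q ^ n)) / (β₁ * q ^ n) := fun n => by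
    field_simp; ring
  have d2 : ∀ n, x - q * L * (1 / (β₁ * q ^ n)) = -(q * L - x * (β₁ * q ^ n)) / (β₁ * q ^ n) :=
    fun n => by field_simp; ring
  refine eq_of_partial_sums 0 0 0 hSm hSp hS
    (tendsto_certificate_infty (x := x) hq hq1 hα₁ hα₂ hM hβ₁ hβ₂ hβ₁ hL hlim) ?_ ?_
  · simp [hβ₁]
  · intro n
    have hy : q ^ n ≠ 0 := pow_ne_zero n hq
    have h1n := h1 n
    have h2n := h2 n
    have h2n' := h2 (n + 1)
    rw [add_zero, kernel_telescope (s := 1 / (β₁ * q ^ n)) hq hα₁ hα₂ hL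
      (by rw [d1]; exact div_ne_zero (neg_ne_zero.2 h1n) (mul_ne_zero hβ₁ hy))
      (by rw [d2]; exact div_ne_zero (neg_ne_zero.2 h2n) (mul_ne_zero hβ₁ hy))
      (by have := hm n; field_simp; linear_combination -this)
      (by have := hp n; field_simp; linear_combination -this), mul_sub, neg_sub_neg]
    congr 1
    rw [d1, d2]
    have hk := hK n
    generalize q ^ 2 * (L - 1) * x / (α₁ * α₂) = c
    rw [hL] at hk h2n' ⊢
    rw [pow_succ] at h2n' ⊢
    generalize q ^ n = y at *
    field_simp at hk h2n' ⊢
    have hD : β₂ * M - x * y * α₁ * α₂ ≠ 0 := fun h => h2n' (by simp [h])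
    rw [neg_inj, div_eq_div_iff (by rwa [← mul_assoc, mul_comm x] at h1n) hD]
    linear_combination -c * hk

/-- The progression is `s = x q^(-n-1)`, so `Kp (n + 2)`, `K (n + 1)` and `Km n` share one `s`. The
unmatched terms are `Kp 0` at `s = x`, and `Kp 1`, `K 0` at `s = x/q`. -/
theorem sum_shifted_beta {K Km Kp : ℕ → ℂ} {S Sm Sp : ℂ} (hq : q ≠ 0)
    (hq1 : ‖q‖ < 1) (hα₁ : α₁ ≠ 0) (hα₂ : α₂ ≠ 0) (hβ₁ : β₁ ≠ 0) (hβ₂ : β₂ ≠ 0) (hx : x ≠ 0)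
    (hM : M ≠ 0) (hL : L = M * (β₁ * β₂) / (α₁ * α₂))
    (h1 : ∀ n : ℕ, 1 - q ^ (n + 1) ≠ 0) (h2 : ∀ n : ℕ, L - q ^ (n + 1) ≠ 0)
    (hp0 : Kp 0 * (q * (1 - 1 / (α₁ * x)) * (1 - q / (α₂ * x))) =
      K 0 * (L * (1 - q / (β₁ * x)) * (1 - q / (β₂ * x))))
    (hm : ∀ n, Km n * (L - q ^ (n + 1)) = K (n + 1) * (1 - q ^ (n + 1)))
    (hp : ∀ n, Kp (n + 1) * (1 - q ^ (n + 1)) = K n * (L - q ^ (n + 1)))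
    (hK : ∀ n, K (n + 1) * ((1 - q ^ 2 / (β₁ * x) * q ^ n) * (1 - q ^ 2 / (β₂ * x) * q ^ n) *
        (1 - q * q ^ n)) =
      q * K n * ((1 - q / (α₁ * x) * q ^ n) * (1 - q ^ 2 / (α₂ * x) * q ^ n) *
        (1 - q / L * q ^ n)))
    (hlim : Tendsto (fun n => K n / q ^ n) atTop (𝓝 1))
    (hS : HasSum K S) (hSm : HasSum Km Sm) (hSp : HasSum Kp Sp) :
    coeffDown q α₁ α₂ β₁ β₂ M x * Sm + coeffUp q α₁ α₂ x * Sp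
      - coeffMid q α₁ α₂ β₁ β₂ M x * S = (L - 1) * x ^ 2 := by
  have hL0 : L ≠ 0 := by rw [hL]; positivity
  have hqx : q / x ≠ 0 := div_ne_zero hq hx
  have d1 : ∀ n : ℕ, x - 1 / (q / x * q ^ n) = -(x * (1 - q ^ (n + 1))) / q ^ (n + 1) := fun n => by
    field_simp; ring
  have d2 : ∀ n : ℕ, x - q * L * (1 / (q / x * q ^ (n + 1))) =
      -(x * (L - q ^ (n + 1))) / q ^ (n + 1) := fun n => by field_simp; ring
  have hstep : ∀ n : ℕ, -(K n * (q ^ 2 * (L - 1) * x / (α₁ * α₂)) *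
      ((1 - α₁ * (1 / (q / x * q ^ n))) * (1 - α₂ * (1 / (q / x * q ^ n)) / q)
        / (x - 1 / (q / x * q ^ n)))) =
      -(K (n + 1) * (q ^ 2 * (L - 1) * x / (α₁ * α₂)) *
      (M * (1 - β₁ * (1 / (q / x * q ^ (n + 1)))) * (1 - β₂ * (1 / (q / x * q ^ (n + 1))))
        / (x - q * L * (1 / (q / x * q ^ (n + 1)))))) := fun n => by
    have hy : q ^ n ≠ 0 := pow_ne_zero n hq
    have h1n := h1 n
    have h2n := h2 n
    have hk := hK n
    rw [d1, d2]
    generalize q ^ 2 * (L - 1) * x / (α₁ * α₂) = c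
    rw [hL] at hk h2n ⊢
    rw [pow_succ] at h1n h2n ⊢
    generalize q ^ n = y at *
    field_simp at hk h2n ⊢
    have hD : β₁ * β₂ * M - q * y * α₁ * α₂ ≠ 0 := fun h => h2n (by simp [h])
    rw [div_eq_div_iff (by rwa [mul_comm y] at h1n) hD]
    linear_combination -c * hk
  refine (eq_of_partial_sums 0 2 1 hSm hSp hS ((tendsto_add_atTop_iff_nat 1).2
    (tendsto_certificate_infty (x := x) hq hq1 hα₁ hα₂ hM hβ₁ hβ₂ hqx hL hlim)) ?_ ?_).trans ?_
  · rw [← hstep 0]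
    have hp1 := hp 0
    simp only [Finset.sum_range_succ, Finset.sum_range_zero, zero_add, pow_one, pow_zero, mul_one,
      mul_zero] at hp1 ⊢
    have hq1' : 1 - q ≠ 0 := by simpa using h1 0
    have hq1'' : q - 1 ≠ 0 := by rw [← neg_ne_zero, neg_sub]; exact hq1'
    have hp1' := eq_div_of_mul_eq hq1' hp1
    -- At `s = x` the denominator `x - s` vanishes; `coeffUp` supplies the factors that `hp0` needs.
    have hB : coeffUp q α₁ α₂ x * Kp 0 =
        x ^ 2 * (K 0 * (L * (1 - q / (β₁ * x)) * (1 - q / (β₂ * x)))) := by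
      rw [← hp0]; unfold coeffUp; field_simp
    have e : x - 1 / (q / x) = -(x * (1 - q)) / q := by field_simp; ring
    rw [mul_add, hB, hp1', e]
    unfold coeffUp coeffMid
    rw [hL]
    field_simp
    ring
  · intro n
    have hy : q ^ (n + 1) ≠ 0 := pow_ne_zero _ hq
    have hy2 : q ^ (n + 2) ≠ 0 := pow_ne_zero _ hq
    have hmn := hm n
    have hpn := hp (n + 1)
    have d3 : x - q * (1 / (q / x * q ^ (n + 1))) = -(x * (1 - q ^ (n + 1))) / q ^ (n + 1) := by
      field_simp; ring
    have d4 : x - L * (1 / (q / x * q ^ (n + 1))) = -(x * (L - q ^ (n + 2))) / q ^ (n + 2) := by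
      field_simp; ring
    rw [add_zero, kernel_telescope (K := K (n + 1)) (s := 1 / (q / x * q ^ (n + 1))) hq hα₁ hα₂ hL
      (by rw [d1]; exact div_ne_zero (neg_ne_zero.2 (mul_ne_zero hx (h1 _))) hy2)
      (by rw [d2]; exact div_ne_zero (neg_ne_zero.2 (mul_ne_zero hx (h2 _))) hy)
      (by rw [d2, d3]; linear_combination (-x / q ^ (n + 1)) * hmn)
      (by rw [d1, d4]; linear_combination (-x / q ^ (n + 2)) * hpn), mul_sub, ← hstep (n + 1)]
    ring
  · field_simp

end

/-! ### Three-term relations for normalized series -/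

/-- The normalized series `(d, e, q; q)_∞ / (a, b, c; q)_∞ ₃φ₂(a, b, c; d, e; q, w)`. -/
noncomputable def phiSum (q a b c d e w : ℂ) : ℂ :=
  qPochInf3 q d e q / qPochInf3 q a b c * phi32 q a b c d e w

section
variable {q α₁ α₂ β₁ β₂ L M x : ℂ}

/-- Covers both `s₀ = 1/α₁` and `s₀ = q/α₂`: by `he`, one of the two `α`-factors becomes that of
`(q; q)_n` and the other that of `(e; q)_n`. -/
theorem phiSum_fixed_alpha {s₀ e : ℂ} (hq : q ≠ 0) (hq1 : ‖q‖ < 1) (hα₁ : α₁ ≠ 0) (hα₂ : α₂ ≠ 0)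
    (hx : x ≠ 0) (hM1 : ‖M‖ < 1) (hL : L = M * (β₁ * β₂) / (α₁ * α₂))
    (h0 : (1 - α₁ * s₀) * (1 - α₂ * s₀ / q) = 0)
    (he : ∀ y, (1 - e * y) * (1 - q * y) = (1 - q * α₁ * s₀ * y) * (1 - α₂ * s₀ * y))
    (ha : Reg q (s₀ / x)) (hd : Reg q (L * s₀ / x)) (hb : Reg q (β₁ * s₀)) (hc : Reg q (β₂ * s₀))
    (hee : Reg q e) :
    coeffDown q α₁ α₂ β₁ β₂ M x *
        phiSum q (q * (q * (s₀ / x))) (β₁ * s₀) (β₂ * s₀) (q * (q * (L * s₀ / x))) e M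
      + coeffUp q α₁ α₂ x * phiSum q (s₀ / x) (β₁ * s₀) (β₂ * s₀) (L * s₀ / x) e M
      - coeffMid q α₁ α₂ β₁ β₂ M x *
        phiSum q (q * (s₀ / x)) (β₁ * s₀) (β₂ * s₀) (q * (L * s₀ / x)) e M = 0 := by
  have d1 : ∀ n : ℕ, x - s₀ * q ^ n = x * (1 - s₀ / x * q ^ n) := fun n => by field_simp
  have d2 : ∀ n : ℕ, x - L * (s₀ * q ^ n) = x * (1 - L * s₀ / x * q ^ n) := fun n => by field_simp
  have d3 : ∀ n : ℕ, x - q * (s₀ * q ^ n) = x * (1 - q * (s₀ / x) * q ^ n) := fun n => by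
    field_simp
  have d4 : ∀ n : ℕ, x - q * L * (s₀ * q ^ n) = x * (1 - q * (L * s₀ / x) * q ^ n) := fun n => by
    field_simp
  have d5 : ∀ n : ℕ, x - s₀ * q ^ (n + 1) = x * (1 - q * (s₀ / x) * q ^ n) := fun n => by
    rw [← d3]; ring
  refine sum_fixed_alpha (s₀ := s₀) hq hq1 hα₁ hα₂ hx hL h0 ?_ ?_ ?_ ?_ ?_
    (hasSum_jTerm hq1 hM1 ha.mul hb hc hd.mul hee)
    (hasSum_jTerm hq1 hM1 ha.mul.mul hb hc hd.mul.mul hee)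
    (hasSum_jTerm hq1 hM1 ha hb hc hd hee)
  · intro n
    rw [d1]
    exact mul_ne_zero hx (ha.sub_ne n)
  · intro n
    rw [d4]
    exact mul_ne_zero hx (hd.mul.sub_ne n)
  · intro n
    rw [d3, d4]
    linear_combination x * jTerm_shift_ad (b := β₁ * s₀) (c := β₂ * s₀) (e := e) (f := q) (w := M)
      (d := q * (L * s₀ / x)) hq1 ha.mul n
  · intro n
    rw [d1, d2]
    linear_combination (-x) * jTerm_shift_ad (b := β₁ * s₀) (c := β₂ * s₀) (e := e) (f := q)
      (w := M) (d := L * s₀ / x) hq1 ha n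
  · intro n
    have h := jTerm_succ (d := q * (L * s₀ / x)) (e := e) (f := q) (w := M) hq1 ha.mul hb hc n
    rw [mul_assoc (1 - _), he] at h
    rw [d4, d5]
    linear_combination x * h

/-- The factors `M⁻¹` and `M` come from `x^μ` at `x/q` and `qx`. -/
theorem phiSum_shifted_alpha (hq : q ≠ 0) (hq1 : ‖q‖ < 1) (hα₁ : α₁ ≠ 0) (hα₂ : α₂ ≠ 0)
    (hβ₁ : β₁ ≠ 0) (hβ₂ : β₂ ≠ 0) (hx : x ≠ 0) (hM0 : M ≠ 0) (hM1 : ‖M‖ < 1)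
    (hL : L = M * (β₁ * β₂) / (α₁ * α₂))
    (ha : Reg q (q / L)) (hb : Reg q (β₁ * (x / L / q))) (hc : Reg q (β₂ * (x / L / q)))
    (hd : Reg q (α₁ * (x / L))) (he : Reg q (α₂ * (x / L / q))) :
    coeffDown q α₁ α₂ β₁ β₂ M x * (M⁻¹ * phiSum q (q / L) (β₁ * (x / L / q)) (β₂ * (x / L / q))
        (α₁ * (x / L)) (α₂ * (x / L / q)) M)
      + coeffUp q α₁ α₂ x * (M * phiSum q (q / L) (q * (q * (β₁ * (x / L / q))))
        (q * (q * (β₂ * (x / L / q)))) (q * (q * (α₁ * (x / L)))) (q * (q * (α₂ * (x / L / q)))) M)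
      - coeffMid q α₁ α₂ β₁ β₂ M x * phiSum q (q / L) (q * (β₁ * (x / L / q)))
        (q * (β₂ * (x / L / q))) (q * (α₁ * (x / L))) (q * (α₂ * (x / L / q))) M = 0 := by
  have r : ∀ n : ℕ, q ^ (n + 1) / L = q / L * q ^ n := fun n => by ring
  have r' : ∀ n : ℕ, q ^ (n + 1) = q * q ^ n := fun n => by ring
  have hqn : ∀ n : ℕ, 1 - q ^ (n + 1) ≠ 0 := fun n => by rw [r']; exact (reg_self hq1).sub_ne n
  have hLn : ∀ n : ℕ, 1 - q ^ (n + 1) / L ≠ 0 := fun n => by rw [r]; exact ha.sub_ne n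
  have s1 := jTerm_shift_bcde (d := α₁ * (x / L)) (e := α₂ * (x / L / q)) (f := q) (w := M)
    hq1 ha hb hc
  have s2 := jTerm_shift_bcde (d := q * (α₁ * (x / L))) (e := q * (α₂ * (x / L / q))) (f := q)
    (w := M) hq1 ha hb.mul hc.mul
  refine sum_shifted_alpha hq hq1 hα₁ hα₂ hβ₁ hβ₂ hx hM0 hL hLn hqn ?_ ?_ ?_ ?_
    (hasSum_jTerm hq1 hM1 ha hb.mul hc.mul hd.mul he.mul)
    ((hasSum_jTerm hq1 hM1 ha hb hc hd he).mul_left _)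
    ((hasSum_jTerm hq1 hM1 ha hb.mul.mul hc.mul.mul hd.mul.mul he.mul.mul).mul_left _)
  · have h := jTerm_succ (d := α₁ * (x / L)) (e := α₂ * (x / L / q)) (f := q) (w := M) hq1 ha hb hc 0
    have h1 := s1 0
    have hL0 := hLn 0
    simp only [pow_zero, mul_one, zero_add, pow_one] at h h1 hL0 ⊢
    apply mul_right_cancel₀ (mul_ne_zero hL0 hM0)
    have e1 : ∀ J b c : ℂ, M⁻¹ * J * (M * b * c) = J * (b * c) := fun J b c => by field_simp
    rw [e1]
    linear_combination (-h + ((1 - α₁ * (x / L)) * (1 - α₂ * (x / L / q))) * h1)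
  · intro n
    rw [r, r', mul_assoc, s1, mul_assoc, inv_mul_cancel_left₀ hM0]
  · intro n
    rw [r, r', s2]
  · intro n
    have h := jTerm_succ (d := q * (α₁ * (x / L))) (e := q * (α₂ * (x / L / q))) (f := q) (w := M)
      hq1 ha hb.mul hc.mul n
    have e1 : ∀ u : ℂ, q * (u * (x / L / q)) = u * (x / L) := fun u => by field_simp
    simp only [e1] at h ⊢
    rw [r, r']
    linear_combination h

theorem phiSum_fixed_beta (hq : q ≠ 0) (hq1 : ‖q‖ < 1) (hα₁ : α₁ ≠ 0) (hα₂ : α₂ ≠ 0)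
    (hβ₁ : β₁ ≠ 0) (hβ₂ : β₂ ≠ 0) (hM0 : M ≠ 0) (hL : L = M * (β₁ * β₂) / (α₁ * α₂))
    (ha : Reg q (β₁ * x / L / q)) (hb : Reg q (β₁ / α₁)) (hc : Reg q (q * β₁ / α₂))
    (hd : Reg q (β₁ * x / q)) (he : Reg q (q * β₁ / β₂)) :
    coeffDown q α₁ α₂ β₁ β₂ M x * (L⁻¹ * phiSum q (β₁ * x / L / q) (β₁ / α₁) (q * β₁ / α₂)
        (β₁ * x / q) (q * β₁ / β₂) q)
      + coeffUp q α₁ α₂ x * (L * phiSum q (q * (q * (β₁ * x / L / q))) (β₁ / α₁) (q * β₁ / α₂)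
        (q * (q * (β₁ * x / q))) (q * β₁ / β₂) q)
      - coeffMid q α₁ α₂ β₁ β₂ M x * phiSum q (q * (β₁ * x / L / q)) (β₁ / α₁) (q * β₁ / α₂)
        (q * (β₁ * x / q)) (q * β₁ / β₂) q = q * (L - 1) * x / β₁ := by
  have hL0 : L ≠ 0 := by rw [hL]; positivity
  have d1 : ∀ n : ℕ, q * L - x * (β₁ * q ^ n) = q * L * (1 - β₁ * x / L / q * q ^ n) := fun n => by
    field_simp
  have d2 : ∀ n : ℕ, q - x * (β₁ * q ^ n) = q * (1 - β₁ * x / q * q ^ n) := fun n => by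
    field_simp
  have d3 : ∀ n : ℕ, 1 - x * (β₁ * q ^ n) = 1 - q * (β₁ * x / q) * q ^ n := fun n => by
    field_simp
  have d4 : ∀ n : ℕ, L - x * (β₁ * q ^ n) = L * (1 - q * (β₁ * x / L / q) * q ^ n) := fun n => by
    field_simp
  refine sum_fixed_beta hq hq1 hα₁ hα₂ hβ₁ hβ₂ hM0 hL ?_ ?_ ?_ ?_ ?_
    (tendsto_jTerm_div hq1 hq ha.mul hb hc hd.mul he (reg_self hq1))
    (hasSum_jTerm hq1 hq1 ha.mul hb hc hd.mul he)
    ((hasSum_jTerm hq1 hq1 ha hb hc hd he).mul_left _)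
    ((hasSum_jTerm hq1 hq1 ha.mul.mul hb hc hd.mul.mul he).mul_left _)
  · intro n
    rw [d3]
    exact hd.mul.sub_ne n
  · intro n
    rw [d1]
    exact mul_ne_zero (mul_ne_zero hq hL0) (ha.sub_ne n)
  · intro n
    have h := jTerm_shift_ad (b := β₁ / α₁) (c := q * β₁ / α₂) (d := β₁ * x / q) (e := q * β₁ / β₂)
      (f := q) (w := q) hq1 ha n
    have hi : L⁻¹ * L = 1 := inv_mul_cancel₀ hL0
    rw [d1, d2, mul_left_comm _ q, h, mul_comm q L, mul_assoc L, mul_mul_mul_comm, hi]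
    ring
  · intro n
    have h := jTerm_shift_ad (b := β₁ / α₁) (c := q * β₁ / α₂) (d := q * (β₁ * x / q))
      (e := q * β₁ / β₂) (f := q) (w := q) hq1 ha.mul n
    rw [d3, d4, mul_assoc, h]
    ring
  · intro n
    have h := jTerm_succ (d := q * (β₁ * x / q)) (e := q * β₁ / β₂) (f := q) (w := q)
      hq1 ha.mul hb hc n
    have e1 : ∀ u : ℂ, q * (u / q) = u := fun u => by field_simp
    simp only [e1] at h ⊢
    exact h

/-- The factors `q/L` and `L/q` come from `x^(λ-1)` at `x/q` and `qx`. -/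
theorem phiSum_shifted_beta (hq : q ≠ 0) (hq1 : ‖q‖ < 1) (hα₁ : α₁ ≠ 0) (hα₂ : α₂ ≠ 0)
    (hβ₁ : β₁ ≠ 0) (hβ₂ : β₂ ≠ 0) (hx : x ≠ 0) (hM0 : M ≠ 0)
    (hL : L = M * (β₁ * β₂) / (α₁ * α₂))
    (ha : Reg q (q / L)) (hb : Reg q (1 / (α₁ * x))) (hc : Reg q (q / (α₂ * x)))
    (hd : Reg q (q / (β₁ * x))) (he : Reg q (q / (β₂ * x))) :
    coeffDown q α₁ α₂ β₁ β₂ M x * (q / L * phiSum q (q / L) (q * (q * (1 / (α₁ * x))))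
        (q * (q * (q / (α₂ * x)))) (q * (q * (q / (β₁ * x)))) (q * (q * (q / (β₂ * x)))) q)
      + coeffUp q α₁ α₂ x * (L / q * phiSum q (q / L) (1 / (α₁ * x)) (q / (α₂ * x))
        (q / (β₁ * x)) (q / (β₂ * x)) q)
      - coeffMid q α₁ α₂ β₁ β₂ M x * phiSum q (q / L) (q * (1 / (α₁ * x))) (q * (q / (α₂ * x)))
        (q * (q / (β₁ * x))) (q * (q / (β₂ * x))) q = (L - 1) * x ^ 2 := by
  have hL0 : L ≠ 0 := by rw [hL]; positivity
  have r : ∀ n : ℕ, L - q ^ (n + 1) = L * (1 - q / L * q ^ n) := fun n => by field_simp; ring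
  have r' : ∀ n : ℕ, q ^ (n + 1) = q * q ^ n := fun n => by ring
  have hqn : ∀ n : ℕ, 1 - q ^ (n + 1) ≠ 0 := fun n => by rw [r']; exact (reg_self hq1).sub_ne n
  have hLn : ∀ n : ℕ, L - q ^ (n + 1) ≠ 0 := fun n => by
    rw [r]; exact mul_ne_zero hL0 (ha.sub_ne n)
  have s1 := jTerm_shift_bcde (d := q / (β₁ * x)) (e := q / (β₂ * x)) (f := q) (w := q) hq1 ha hb hc
  have s2 := jTerm_shift_bcde (d := q * (q / (β₁ * x))) (e := q * (q / (β₂ * x))) (f := q) (w := q)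
    hq1 ha hb.mul hc.mul
  refine sum_shifted_beta hq hq1 hα₁ hα₂ hβ₁ hβ₂ hx hM0 hL hqn hLn ?_ ?_ ?_ ?_
    (tendsto_jTerm_div hq1 hq ha hb.mul hc.mul hd.mul he.mul (reg_self hq1))
    (hasSum_jTerm hq1 hq1 ha hb.mul hc.mul hd.mul he.mul)
    ((hasSum_jTerm hq1 hq1 ha hb.mul.mul hc.mul.mul hd.mul.mul he.mul.mul).mul_left _)
    ((hasSum_jTerm hq1 hq1 ha hb hc hd he).mul_left _)
  · have h := jTerm_succ (d := q / (β₁ * x)) (e := q / (β₂ * x)) (f := q) (w := q) hq1 ha hb hc 0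
    have h1 := s1 0
    have hL1 := ha.sub_ne 0
    simp only [pow_zero, mul_one, zero_add] at h h1 hL1 ⊢
    apply mul_right_cancel₀ (mul_ne_zero hL1 hq)
    rw [div_mul_eq_mul_div, div_mul_eq_mul_div, div_mul_eq_mul_div, div_eq_iff hq]
    linear_combination q * L * (-h + ((1 - q / (β₁ * x)) * (1 - q / (β₂ * x))) * h1)
  · intro n
    have := s2 n
    rw [r, r', this]
    field_simp
  · intro n
    have := s1 n
    rw [r, r', mul_assoc, this]
    field_simp
  · intro n
    have h := jTerm_succ (d := q * (q / (β₁ * x))) (e := q * (q / (β₂ * x))) (f := q) (w := q)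
      hq1 ha hb.mul hc.mul n
    have e1 : ∀ u : ℂ, q * (q / u) = q ^ 2 / u := fun u => by ring
    rw [mul_one_div] at h ⊢
    simp only [e1] at h ⊢
    linear_combination h

end

/-! ### Powers, and the solutions as normalized series -/

theorem lpow_add (A s t : ℂ) : lpow A (s + t) = lpow A s * lpow A t := by
  simp [lpow, add_mul, Complex.exp_add]

theorem lpow_neg (A s : ℂ) : lpow A (-s) = (lpow A s)⁻¹ := by
  simp [lpow, Complex.exp_neg]

theorem lpow_ne_zero (A s : ℂ) : lpow A s ≠ 0 := Complex.exp_ne_zero _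

theorem lpow_add_left (A B s : ℂ) : lpow (A + B) s = lpow A s * lpow B s := by
  simp [lpow, mul_add, Complex.exp_add]

theorem lpow_sub_left (A B s : ℂ) : lpow (A - B) s = lpow A s / lpow B s := by
  simp [lpow, mul_sub, Complex.exp_sub]

theorem lpow_one (A : ℂ) : lpow A 1 = Complex.exp A := by simp [lpow]

theorem lpow_two (A : ℂ) : lpow A 2 = Complex.exp A ^ 2 := by
  rw [lpow, ← Complex.exp_nat_mul]; norm_num

/-- For real `μ` the modulus is `exp (μ Re τ)`, and `Re τ < 0`; for complex `μ` it would also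
involve `Im τ`. -/
theorem norm_lpow_lt_one {q τ : ℂ} (hq1 : ‖q‖ < 1) (hτ : Complex.exp τ = q) {μ : ℝ} (hμ : 0 < μ) :
    ‖lpow τ μ‖ < 1 := by
  rw [← hτ, Complex.norm_exp, Real.exp_lt_one_iff] at hq1
  rw [lpow, Complex.norm_exp, Real.exp_lt_one_iff, Complex.re_ofReal_mul]
  exact mul_neg_of_pos_of_neg hμ hq1

theorem reg_div {q a b : ℂ} (hb : b ≠ 0) (h : ∀ n : ℕ, a * q ^ n ≠ b) : Reg q (a / b) := fun n => by
  rw [div_mul_eq_mul_div, Ne, div_eq_one_iff_eq hb]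
  exact h n

theorem eqLHS_eq {q τ : ℂ} (hτ : Complex.exp τ = q) (α₁ α₂ β₁ β₂ μ : ℂ) (g : ℂ → ℂ) (z : ℂ) :
    eqLHS q τ α₁ α₂ β₁ β₂ μ g z =
      coeffDown q α₁ α₂ β₁ β₂ (lpow τ μ) (Complex.exp z) * g (z - τ)
      + coeffUp q α₁ α₂ (Complex.exp z) * g (z + τ)
      - coeffMid q α₁ α₂ β₁ β₂ (lpow τ μ) (Complex.exp z) * g z := by
  simp only [eqLHS, coeffDown, coeffUp, coeffMid, lpow_add, lpow_one, lpow_two, hτ,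
    mul_comm (lpow τ μ)]

section
variable {q τ : ℂ} (α₁ α₂ β₁ β₂ l μ : ℂ)

theorem gInvAlpha₁_eq (A₁ z : ℂ) : gInvAlpha₁ q τ α₁ α₂ β₁ β₂ l μ A₁ z =
    (q - 1) * lpow A₁ (-μ) * phiSum q (q / (α₁ * Complex.exp z)) (β₁ / α₁) (β₂ / α₁)
      (lpow τ (l + 1) / (α₁ * Complex.exp z)) (α₂ / α₁) (lpow τ μ) := by
  simp only [gInvAlpha₁, phiSum, qPochInf3]
  ring

theorem gInvAlpha₂_eq (A₂ z : ℂ) : gInvAlpha₂ q τ α₁ α₂ β₁ β₂ l μ A₂ z =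
    (q - 1) * lpow τ μ * lpow A₂ (-μ) *
      phiSum q (q ^ 2 / (α₂ * Complex.exp z)) (q * β₁ / α₂) (q * β₂ / α₂)
        (lpow τ (l + 2) / (α₂ * Complex.exp z)) (q ^ 2 * α₁ / α₂) (lpow τ μ) := by
  simp only [gInvAlpha₂, phiSum, qPochInf3]
  ring

theorem gQLamX_eq (z : ℂ) : gQLamX q τ α₁ α₂ β₁ β₂ l μ z =
    (q - 1) * lpow τ (-(l * μ)) * lpow z μ *
      phiSum q (lpow τ (-l + 1)) (lpow τ (-l) * β₁ * Complex.exp z)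
        (lpow τ (-l) * β₂ * Complex.exp z) (lpow τ (-l + 1) * α₁ * Complex.exp z)
        (lpow τ (-l) * α₂ * Complex.exp z) (lpow τ μ) := by
  simp only [gQLamX, phiSum, qPochInf3]
  ring

theorem gInvBeta₁_eq (z : ℂ) : gInvBeta₁ q τ α₁ α₂ β₁ β₂ l z =
    (1 - q) * β₁ / α₁ * lpow z l *
      phiSum q (lpow τ (-l) * β₁ * Complex.exp z) (β₁ / α₁) (q * β₁ / α₂) (β₁ * Complex.exp z)
        (q * β₁ / β₂) q := by
  simp only [gInvBeta₁, phiSum, qPochInf3, mul_right_comm _ (Complex.exp z)]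
  ring

/-- Brings `q^(1-λ)`, the upper parameter free of `x`, to the first slot, as `phiSum_shifted_beta`
requires. -/
theorem phi32_rotate (q a b c d e w : ℂ) : phi32 q a b c d e w = phi32 q c a b d e w := by
  unfold phi32 phi32Term
  congr 1
  funext n
  ring

theorem gX_eq (z : ℂ) : gX q τ α₁ α₂ β₁ β₂ l z =
    (1 - q) * q / α₁ * lpow z (l - 1) *
      phiSum q (lpow τ (1 - l)) (q / (α₁ * Complex.exp z)) (q ^ 2 / (α₂ * Complex.exp z))
        (q ^ 2 / (β₁ * Complex.exp z)) (q ^ 2 / (β₂ * Complex.exp z)) q := by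
  simp only [gX, phiSum, qPochInf3, phi32_rotate q _ _ (lpow τ (1 - l))]
  ring

end

/-! ### The five solutions -/

section
variable {q τ α₁ α₂ β₁ β₂ l μ z : ℂ}

theorem eqLHS_gInvAlpha₁ (hq : q ≠ 0) (hq1 : ‖q‖ < 1) (hτ : Complex.exp τ = q) (hα₁ : α₁ ≠ 0)
    (hα₂ : α₂ ≠ 0) (hM1 : ‖lpow τ μ‖ < 1) (hL : lpow τ l = lpow τ μ * (β₁ * β₂) / (α₁ * α₂)) (A₁ : ℂ)
    (h : ∀ n : ℕ, α₁ * Complex.exp z ≠ q ^ n ∧ α₁ * Complex.exp z ≠ lpow τ l * q ^ n ∧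
      β₁ * q ^ n ≠ α₁ ∧ β₂ * q ^ n ≠ α₁ ∧ α₂ * q ^ n ≠ α₁) :
    eqLHS q τ α₁ α₂ β₁ β₂ μ (gInvAlpha₁ q τ α₁ α₂ β₁ β₂ l μ A₁) z = 0 := by
  have hx : Complex.exp z ≠ 0 := Complex.exp_ne_zero z
  rw [eqLHS_eq hτ]
  simp only [gInvAlpha₁_eq, Complex.exp_sub, Complex.exp_add, lpow_add, lpow_one, hτ]
  generalize Complex.exp z = x at *
  generalize lpow τ l = L at *
  generalize lpow τ μ = M at *
  have key := phiSum_fixed_alpha (s₀ := 1 / α₁) (e := α₂ / α₁) hq hq1 hα₁ hα₂ hx hM1 hL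
    (by field_simp; simp) (fun y => by field_simp)
    (by rw [div_div]; exact reg_div (mul_ne_zero hα₁ hx) fun n => by simpa using (h n).1.symm)
    (by rw [mul_one_div, div_div]; exact reg_div (mul_ne_zero hα₁ hx) fun n => (h n).2.1.symm)
    (by rw [mul_one_div]; exact reg_div hα₁ fun n => (h n).2.2.1)
    (by rw [mul_one_div]; exact reg_div hα₁ fun n => (h n).2.2.2.1)
    (reg_div hα₁ fun n => (h n).2.2.2.2)
  have e1 : q / (α₁ * (x / q)) = q * (q * (1 / α₁ / x)) := by field_simp
  have e2 : L * q / (α₁ * (x / q)) = q * (q * (L * (1 / α₁) / x)) := by field_simp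
  have e3 : q / (α₁ * (x * q)) = 1 / α₁ / x := by field_simp
  have e4 : L * q / (α₁ * (x * q)) = L * (1 / α₁) / x := by field_simp
  have e5 : q / (α₁ * x) = q * (1 / α₁ / x) := by field_simp
  have e6 : L * q / (α₁ * x) = q * (L * (1 / α₁) / x) := by field_simp
  rw [e1, e2, e3, e4, e5, e6, ← mul_one_div β₁, ← mul_one_div β₂]
  linear_combination (q - 1) * lpow A₁ (-μ) * key

theorem eqLHS_gInvAlpha₂ (hq : q ≠ 0) (hq1 : ‖q‖ < 1) (hτ : Complex.exp τ = q) (hα₁ : α₁ ≠ 0)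
    (hα₂ : α₂ ≠ 0) (hM1 : ‖lpow τ μ‖ < 1) (hL : lpow τ l = lpow τ μ * (β₁ * β₂) / (α₁ * α₂)) (A₂ : ℂ)
    (h : ∀ n : ℕ, α₂ * Complex.exp z ≠ q ^ (n + 1) ∧
      α₂ * Complex.exp z ≠ lpow τ (l + 1) * q ^ n ∧
      β₁ * q ^ (n + 1) ≠ α₂ ∧ β₂ * q ^ (n + 1) ≠ α₂ ∧ α₁ * q ^ (n + 2) ≠ α₂) :
    eqLHS q τ α₁ α₂ β₁ β₂ μ (gInvAlpha₂ q τ α₁ α₂ β₁ β₂ l μ A₂) z = 0 := by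
  have hx : Complex.exp z ≠ 0 := Complex.exp_ne_zero z
  rw [eqLHS_eq hτ]
  simp only [gInvAlpha₂_eq, Complex.exp_sub, Complex.exp_add, lpow_add, lpow_one, lpow_two, hτ]
    at h ⊢
  generalize Complex.exp z = x at *
  generalize lpow τ l = L at *
  generalize lpow τ μ = M at *
  -- The start `q/α₂`, rather than `1/α₂`, is the zero of `1 - α₂s/q`.
  have key := phiSum_fixed_alpha (s₀ := q / α₂) (e := q ^ 2 * α₁ / α₂) hq hq1 hα₁ hα₂ hx hM1 hL
    (by field_simp; simp) (fun y => by field_simp)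
    (by
      rw [div_div]
      exact reg_div (mul_ne_zero hα₂ hx) fun n => by rw [← pow_succ']; exact (h n).1.symm)
    (by rw [← mul_div_assoc, div_div]; exact reg_div (mul_ne_zero hα₂ hx) fun n => (h n).2.1.symm)
    (by
      rw [← mul_div_assoc]
      exact reg_div hα₂ fun n => by rw [mul_assoc, ← pow_succ']; exact (h n).2.2.1)
    (by
      rw [← mul_div_assoc]
      exact reg_div hα₂ fun n => by rw [mul_assoc, ← pow_succ']; exact (h n).2.2.2.1)
    (reg_div hα₂ fun n => by
      rw [mul_comm (q ^ 2), mul_assoc, ← pow_add, add_comm 2]; exact (h n).2.2.2.2)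
  have e1 : q ^ 2 / (α₂ * (x / q)) = q * (q * (q / α₂ / x)) := by field_simp
  have e2 : L * q ^ 2 / (α₂ * (x / q)) = q * (q * (L * (q / α₂) / x)) := by field_simp
  have e3 : q ^ 2 / (α₂ * (x * q)) = q / α₂ / x := by field_simp
  have e4 : L * q ^ 2 / (α₂ * (x * q)) = L * (q / α₂) / x := by field_simp
  have e5 : q ^ 2 / (α₂ * x) = q * (q / α₂ / x) := by field_simp
  have e6 : L * q ^ 2 / (α₂ * x) = q * (L * (q / α₂) / x) := by field_simp
  have e7 : ∀ b : ℂ, q * b / α₂ = b * (q / α₂) := fun b => by ring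
  rw [e1, e2, e3, e4, e5, e6, e7, e7]
  linear_combination (q - 1) * M * lpow A₂ (-μ) * key

theorem eqLHS_gQLamX (hq : q ≠ 0) (hq1 : ‖q‖ < 1) (hτ : Complex.exp τ = q) (hα₁ : α₁ ≠ 0)
    (hα₂ : α₂ ≠ 0) (hβ₁ : β₁ ≠ 0) (hβ₂ : β₂ ≠ 0) (hM1 : ‖lpow τ μ‖ < 1)
    (hL : lpow τ l = lpow τ μ * (β₁ * β₂) / (α₁ * α₂))
    (h : ∀ n : ℕ, q ^ (n + 1) ≠ lpow τ l ∧
      β₁ * Complex.exp z * q ^ n ≠ lpow τ (l + 1) ∧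
      β₂ * Complex.exp z * q ^ n ≠ lpow τ (l + 1) ∧
      α₁ * Complex.exp z * q ^ n ≠ lpow τ l ∧
      α₂ * Complex.exp z * q ^ n ≠ lpow τ (l + 1)) :
    eqLHS q τ α₁ α₂ β₁ β₂ μ (gQLamX q τ α₁ α₂ β₁ β₂ l μ) z = 0 := by
  have hx : Complex.exp z ≠ 0 := Complex.exp_ne_zero z
  have hL0 : lpow τ l ≠ 0 := lpow_ne_zero _ _
  have hM0 : lpow τ μ ≠ 0 := lpow_ne_zero _ _
  rw [eqLHS_eq hτ]
  simp only [gQLamX_eq, Complex.exp_sub, Complex.exp_add, lpow_add, lpow_neg τ l, lpow_one,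
    lpow_sub_left, lpow_add_left, hτ] at h ⊢
  generalize Complex.exp z = x at *
  generalize lpow τ l = L at *
  generalize lpow τ μ = M at *
  have r : ∀ {a : ℂ}, (∀ n : ℕ, a * x * q ^ n ≠ L * q) → Reg q (a * (x / L / q)) := fun ha => by
    rw [div_div, ← mul_div_assoc]
    exact reg_div (mul_ne_zero hL0 hq) ha
  have key := phiSum_shifted_alpha hq hq1 hα₁ hα₂ hβ₁ hβ₂ hx hM0 hM1 hL
    (reg_div hL0 fun n => by rw [← pow_succ']; exact (h n).1)
    (r fun n => (h n).2.1) (r fun n => (h n).2.2.1)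
    (by rw [← mul_div_assoc]; exact reg_div hL0 fun n => (h n).2.2.2.1)
    (r fun n => (h n).2.2.2.2)
  have e1 : ∀ a : ℂ, L⁻¹ * a * (x / q) = a * (x / L / q) := fun a => by ring
  have e2 : ∀ a : ℂ, L⁻¹ * a * (x * q) = q * (q * (a * (x / L / q))) := fun a => by field_simp
  have e3 : ∀ a : ℂ, L⁻¹ * a * x = q * (a * (x / L / q)) := fun a => by field_simp
  have e4 : L⁻¹ * q * α₁ * (x / q) = α₁ * (x / L) := by field_simp
  have e5 : L⁻¹ * q * α₁ * (x * q) = q * (q * (α₁ * (x / L))) := by ring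
  have e6 : L⁻¹ * q * α₁ * x = q * (α₁ * (x / L)) := by ring
  have e7 : L⁻¹ * q = q / L := by ring
  rw [e4, e5, e6, e7]
  simp only [e1, e2, e3]
  linear_combination (q - 1) * lpow τ (-(l * μ)) * lpow z μ * key

theorem eqLHS_gInvBeta₁ (hq : q ≠ 0) (hq1 : ‖q‖ < 1) (hτ : Complex.exp τ = q) (hα₁ : α₁ ≠ 0)
    (hα₂ : α₂ ≠ 0) (hβ₁ : β₁ ≠ 0) (hβ₂ : β₂ ≠ 0)
    (hL : lpow τ l = lpow τ μ * (β₁ * β₂) / (α₁ * α₂))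
    (h : ∀ n : ℕ, β₁ * Complex.exp z * q ^ n ≠ lpow τ (l + 1) ∧
      β₁ * q ^ n ≠ α₁ ∧ β₁ * q ^ (n + 1) ≠ α₂ ∧
      β₁ * Complex.exp z * q ^ n ≠ q ∧ β₁ * q ^ (n + 1) ≠ β₂) :
    eqLHS q τ α₁ α₂ β₁ β₂ μ (gInvBeta₁ q τ α₁ α₂ β₁ β₂ l) z
      + q * (1 - q) * (1 - lpow τ l) / α₁ * lpow z (l + 1) = 0 := by
  have hL0 : lpow τ l ≠ 0 := lpow_ne_zero _ _
  have hM0 : lpow τ μ ≠ 0 := lpow_ne_zero _ _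
  rw [eqLHS_eq hτ]
  simp only [gInvBeta₁_eq, Complex.exp_sub, Complex.exp_add, lpow_add, lpow_neg τ l, lpow_one,
    lpow_sub_left, lpow_add_left, hτ] at h ⊢
  generalize Complex.exp z = x at *
  generalize lpow τ l = L at *
  generalize lpow τ μ = M at *
  generalize lpow z l = Z at *
  have key := phiSum_fixed_beta (x := x) hq hq1 hα₁ hα₂ hβ₁ hβ₂ hM0 hL
    (by rw [div_div]; exact reg_div (mul_ne_zero hL0 hq) fun n => (h n).1)
    (reg_div hα₁ fun n => (h n).2.1)
    (reg_div hα₂ fun n => by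
      rw [mul_comm q, mul_assoc, ← pow_succ']; exact (h n).2.2.1)
    (reg_div hq fun n => (h n).2.2.2.1)
    (reg_div hβ₂ fun n => by
      rw [mul_comm q, mul_assoc, ← pow_succ']; exact (h n).2.2.2.2)
  have e1 : L⁻¹ * β₁ * (x / q) = β₁ * x / L / q := by ring
  have e2 : L⁻¹ * β₁ * (x * q) = q * (q * (β₁ * x / L / q)) := by field_simp
  have e3 : L⁻¹ * β₁ * x = q * (β₁ * x / L / q) := by field_simp
  have e4 : β₁ * (x / q) = β₁ * x / q := by ring
  have e5 : β₁ * (x * q) = q * (q * (β₁ * x / q)) := by field_simp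
  have e6 : phiSum q (q * (β₁ * x / L / q)) (β₁ / α₁) (q * β₁ / α₂) (β₁ * x) (q * β₁ / β₂) q =
      phiSum q (q * (β₁ * x / L / q)) (β₁ / α₁) (q * β₁ / α₂) (q * (β₁ * x / q))
        (q * β₁ / β₂) q := by
    rw [mul_div_cancel₀ (β₁ * x) hq]
  -- The limit at infinity times the prefactor of `g` is minus the inhomogeneous term.
  have e7 : (1 - q) * β₁ / α₁ * Z * (q * (L - 1) * x / β₁) =
      -(q * (1 - q) * (1 - L) / α₁ * (Z * x)) := by field_simp; ring
  rw [e1, e2, e3, e4, e5, e6]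
  linear_combination (1 - q) * β₁ / α₁ * Z * key + e7

theorem eqLHS_gX (hq : q ≠ 0) (hq1 : ‖q‖ < 1) (hτ : Complex.exp τ = q) (hα₁ : α₁ ≠ 0)
    (hα₂ : α₂ ≠ 0) (hβ₁ : β₁ ≠ 0) (hβ₂ : β₂ ≠ 0)
    (hL : lpow τ l = lpow τ μ * (β₁ * β₂) / (α₁ * α₂))
    (h : ∀ n : ℕ, α₁ * Complex.exp z ≠ q ^ n ∧ α₂ * Complex.exp z ≠ q ^ (n + 1) ∧
      q ^ (n + 1) ≠ lpow τ l ∧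
      β₁ * Complex.exp z ≠ q ^ (n + 1) ∧ β₂ * Complex.exp z ≠ q ^ (n + 1)) :
    eqLHS q τ α₁ α₂ β₁ β₂ μ (gX q τ α₁ α₂ β₁ β₂ l) z
      + q * (1 - q) * (1 - lpow τ l) / α₁ * lpow z (l + 1) = 0 := by
  have hx : Complex.exp z ≠ 0 := Complex.exp_ne_zero z
  have hL0 : lpow τ l ≠ 0 := lpow_ne_zero _ _
  have hM0 : lpow τ μ ≠ 0 := lpow_ne_zero _ _
  rw [eqLHS_eq hτ]
  simp only [gX_eq, sub_eq_add_neg l, sub_eq_add_neg (1 : ℂ) l, Complex.exp_sub, Complex.exp_add,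
    lpow_add, lpow_neg, lpow_one, lpow_sub_left, lpow_add_left, hτ]
  generalize Complex.exp z = x at *
  generalize lpow τ l = L at *
  generalize lpow τ μ = M at *
  generalize lpow z l = Z at *
  have r : ∀ {a : ℂ}, a ≠ 0 → (∀ n : ℕ, a * x ≠ q ^ (n + 1)) → Reg q (q / (a * x)) :=
    fun ha h => reg_div (mul_ne_zero ha hx) fun n => by rw [← pow_succ']; exact (h n).symm
  have key := phiSum_shifted_beta hq hq1 hα₁ hα₂ hβ₁ hβ₂ hx hM0 hL
    (reg_div hL0 fun n => by rw [← pow_succ']; exact (h n).2.2.1)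
    (reg_div (mul_ne_zero hα₁ hx) fun n => by rw [one_mul]; exact (h n).1.symm)
    (r hα₂ fun n => (h n).2.1) (r hβ₁ fun n => (h n).2.2.2.1) (r hβ₂ fun n => (h n).2.2.2.2)
  have e1 : ∀ a : ℂ, q ^ 2 / (a * (x / q)) = q * (q * (q / (a * x))) := fun a => by field_simp
  have e2 : ∀ a : ℂ, q ^ 2 / (a * (x * q)) = q / (a * x) := fun a => by
    rw [pow_two, ← mul_assoc, mul_div_mul_right _ _ hq]
  have e3 : ∀ a : ℂ, q ^ 2 / (a * x) = q * (q / (a * x)) := fun a => by ring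
  have e4 : q / (α₁ * (x / q)) = q * (q * (1 / (α₁ * x))) := by field_simp
  have e5 : q / (α₁ * (x * q)) = 1 / (α₁ * x) := by field_simp
  have e6 : q / (α₁ * x) = q * (1 / (α₁ * x)) := by ring
  have e7 : q * L⁻¹ = q / L := by ring
  -- The prefactor has `x^(λ-1)`, so the `x²` on the right of `key` yields `x^(λ+1)`.
  have e8 : (1 - q) * q / α₁ * (Z * x⁻¹) * ((L - 1) * x ^ 2) =
      -(q * (1 - q) * (1 - L) / α₁ * (Z * x)) := by field_simp; ring
  have e9 : (x / q)⁻¹ = x⁻¹ * q := by rw [inv_div, div_eq_mul_inv, mul_comm]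
  simp only [e1, e2, e3]
  rw [e4, e5, e6, e7, e9]
  linear_combination (1 - q) * q / α₁ * (Z * x⁻¹) * key + e8

end

end QMC

theorem propositionA3 (q τ : ℂ) (hq0 : 0 < ‖q‖) (hq1 : ‖q‖ < 1) (hτ : Complex.exp τ = q)
    (α₁ α₂ β₁ β₂ : ℂ) (hα₁ : α₁ ≠ 0) (hα₂ : α₂ ≠ 0) (hβ₁ : β₁ ≠ 0) (hβ₂ : β₂ ≠ 0) :
    -- the homogeneous equation, for `μ > 0`; in each case the side conditions say that no
    -- denominator of the function vanishes at `x / q`, `x` and `q x`, where `x = exp z`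
    (∀ (μ : ℝ) (l : ℂ), 0 < μ → lpow τ l = lpow τ μ * (β₁ * β₂) / (α₁ * α₂) →
      ∀ z : ℂ,
        (∀ A₁ : ℂ, Complex.exp A₁ = α₁ →
          (∀ n : ℕ, α₁ * Complex.exp z ≠ q ^ n ∧ α₁ * Complex.exp z ≠ lpow τ l * q ^ n ∧
            β₁ * q ^ n ≠ α₁ ∧ β₂ * q ^ n ≠ α₁ ∧ α₂ * q ^ n ≠ α₁) →
          eqLHS q τ α₁ α₂ β₁ β₂ μ (gInvAlpha₁ q τ α₁ α₂ β₁ β₂ l μ A₁) z = 0) ∧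
        (∀ A₂ : ℂ, Complex.exp A₂ = α₂ →
          (∀ n : ℕ, α₂ * Complex.exp z ≠ q ^ (n + 1) ∧
            α₂ * Complex.exp z ≠ lpow τ (l + 1) * q ^ n ∧
            β₁ * q ^ (n + 1) ≠ α₂ ∧ β₂ * q ^ (n + 1) ≠ α₂ ∧ α₁ * q ^ (n + 2) ≠ α₂) →
          eqLHS q τ α₁ α₂ β₁ β₂ μ (gInvAlpha₂ q τ α₁ α₂ β₁ β₂ l μ A₂) z = 0) ∧
        ((∀ n : ℕ, q ^ (n + 1) ≠ lpow τ l ∧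
            β₁ * Complex.exp z * q ^ n ≠ lpow τ (l + 1) ∧
            β₂ * Complex.exp z * q ^ n ≠ lpow τ (l + 1) ∧
            α₁ * Complex.exp z * q ^ n ≠ lpow τ l ∧
            α₂ * Complex.exp z * q ^ n ≠ lpow τ (l + 1)) →
          eqLHS q τ α₁ α₂ β₁ β₂ μ (gQLamX q τ α₁ α₂ β₁ β₂ l μ) z = 0)) ∧
    -- the non-homogeneous equation
    (∀ (μ l : ℂ), lpow τ l = lpow τ μ * (β₁ * β₂) / (α₁ * α₂) →
      ∀ z : ℂ,
        ((∀ n : ℕ, β₁ * Complex.exp z * q ^ n ≠ lpow τ (l + 1) ∧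
            β₁ * q ^ n ≠ α₁ ∧ β₁ * q ^ (n + 1) ≠ α₂ ∧
            β₁ * Complex.exp z * q ^ n ≠ q ∧ β₁ * q ^ (n + 1) ≠ β₂) →
          eqLHS q τ α₁ α₂ β₁ β₂ μ (gInvBeta₁ q τ α₁ α₂ β₁ β₂ l) z
            + q * (1 - q) * (1 - lpow τ l) / α₁ * lpow z (l + 1) = 0) ∧
        ((∀ n : ℕ, α₁ * Complex.exp z ≠ q ^ n ∧ α₂ * Complex.exp z ≠ q ^ (n + 1) ∧
            q ^ (n + 1) ≠ lpow τ l ∧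
            β₁ * Complex.exp z ≠ q ^ (n + 1) ∧ β₂ * Complex.exp z ≠ q ^ (n + 1)) →
          eqLHS q τ α₁ α₂ β₁ β₂ μ (gX q τ α₁ α₂ β₁ β₂ l) z
            + q * (1 - q) * (1 - lpow τ l) / α₁ * lpow z (l + 1) = 0)) := by

  have hq : q ≠ 0 := norm_pos_iff.1 hq0
  refine ⟨fun μ l hμ hL z => ?_, fun μ l hL z => ⟨?_, ?_⟩⟩
  -- Positivity of `μ` enters only here, for convergence of the series with argument `q^μ`.
  · have hM := norm_lpow_lt_one hq1 hτ hμ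
    exact ⟨fun A₁ _ h => eqLHS_gInvAlpha₁ hq hq1 hτ hα₁ hα₂ hM hL A₁ h,
      fun A₂ _ h => eqLHS_gInvAlpha₂ hq hq1 hτ hα₁ hα₂ hM hL A₂ h,
      eqLHS_gQLamX hq hq1 hτ hα₁ hα₂ hβ₁ hβ₂ hM hL⟩
  · exact eqLHS_gInvBeta₁ hq hq1 hτ hα₁ hα₂ hβ₁ hβ₂ hL
  · exact eqLHS_gX hq hq1 hτ hα₁ hα₂ hβ₁ hβ₂ hL
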